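/- **Theorem (existence and regularity of spline interpolations).** Let $\mathbf V$ be a separable real Hilbert space, compactly embedded in a real Banach space $\mathbf Y$ (so the inclusion $\mathbf V\hookrightarrow\mathbf Y$ is an injective compact linear operator), and let $g$ be an admissible Riemannian metric on the manifold $\mathcal M=\mathbf V$, i.e. $g$ can be extended to a function $g:\mathbf Y\times\mathbf V\times\mathbf V\to\mathbb R$ of the form $g_y(v,w)=g^c_y(v,w)+Q(v,w)$ such that, for all $y\in\mathbf Y$ and $v\in\mathbf V$ and with constants $C^*$, $C^{**}$ and $c^*>0$ independent of $y$ and $v$: * $g^c_y$ is symmetric on $\mathbf V\times\mathbf V$ and $g^c_y(v,v)\le C^*\|v\|_{\mathbf Y}^2$; * $y\mapsto g^c_y$ is twice Fréchet differentiable, with bounded first and second derivatives, as a map from $\mathbf Y$ into the space of bounded bilinear forms on $\mathbf Y$ with the operator norm; * $Q$ is a symmetric positive semi-definite bilinear form on $\mathbf V$ with $Q(v,v)\le C^{**}\|v\|_{\mathbf V}^2$; * $g_y(v,v)\ge c^*\|v\|_{\mathbf V}^2$. For $y,v,w\in\mathbf V$ let the Christoffel operator $\Gamma_y(v,w)\in\mathbf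 V$ be defined by $$2g_y(\Gamma_y(v,w),z)=(D_yg_y)(w)(v,z)-(D_yg_y)(z)(v,w)+(D_yg_y)(v)(w,z)\quad\text{for all }z\in\mathbf V .$$ For $y\in W^{2,2}((0,1);\mathbf V)$, identified with its $C^1([0,1];\mathbf V)$ representative, write $\tfrac{D}{dt}\dot y=\ddot y+\Gamma_y(\dot y,\dot y)$ and $$\mathcal E[y]=\int_0^1 g_{y(t)}(\dot y(t),\dot y(t))\,dt,\qquad \mathcal F[y]=\int_0^1 g_{y(t)}\big(\tfrac{D}{dt}\dot y(t),\tfrac{D}{dt}\dot y(t)\big)\,dt,\qquad \mathcal F^\sigma=\mathcal F+\sigma\mathcal E .$$ Let $\sigma>0$, $I\ge1$, $0\le t_1<\dots<t_I\le1$ and $\bar y_1,\dots,\bar y_I\in\mathbf V$. Fix one of the following boundary conditions: * natural: no condition is imposed on $y$ (the condition $\tfrac{D}{dt}\dot y(0)=\tfrac{D}{dt}\dot y(1)=0$ is understood as the one that arises by itself for minimizers); * Hermite: $\dot y(0)=v_0$ and $\dot y(1)=v_1$ for given $v_0,v_1\in\mathbf V$, where in this case $t_1=0$ and $t_I=1$;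 * periodic: $y(0)=y(1)$ and $\dot y(0)=\dot y(1)$, where in this case $t_1\ne0$ or $t_I\ne1$. Call $y$ a spline interpolation if it minimizes $\mathcal F^\sigma$ among all curves in $W^{2,2}((0,1);\mathbf V)$ that satisfy $y(t_i)=\bar y_i$ for $i=1,\dots,I$ and the chosen boundary condition. Then a spline interpolation exists. Moreover, every spline interpolation $y$ belongs to $C^{2,\frac12}([\delta,1-\delta];\mathbf V)$ for every $\delta\in(0,\tfrac12)$, that is, $y$ is twice continuously differentiable on $[\delta,1-\delta]$ and $\ddot y$ is Hölder continuous there with exponent $\tfrac12$. -/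

import Mathlib

open Set MeasureTheory
open scoped ContDiff

noncomputable section

namespace RiemannianSpline

section Metric

variable {V Y : Type*} [NormedAddCommGroup V] [InnerProductSpace ℝ V]
  [NormedAddCommGroup Y] [NormedSpace ℝ Y]

/-- `f` is twice (Fréchet) differentiable with bounded first and second derivatives. -/
def TwiceDifferentiableBounded {E F : Type*} [NormedAddCommGroup E] [NormedSpace ℝ E]
    [NormedAddCommGroup F] [NormedSpace ℝ F] (f : E → F) : Prop :=
  Differentiable ℝ f ∧ Differentiable ℝ (fderiv ℝ f) ∧
    (∃ C : ℝ, ∀ x : E, ‖fderiv ℝ f x‖ ≤ C) ∧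
    (∃ C : ℝ, ∀ x : E, ‖fderiv ℝ (fderiv ℝ f) x‖ ≤ C)

/-- Admissibility of a Riemannian metric `g` on the manifold `V`, where `ι : V → Y` is the
embedding: `g` extends to `Y × V × V` as a compact part `gc` plus a position-independent quadratic
part `Q`. Bilinear forms on `Y` carry the operator norm, which on `Y' ⊗ Y'` is the injective
cross norm. -/
def IsAdmissibleMetric (ι : V →L[ℝ] Y) (g : V → V →L[ℝ] V →L[ℝ] ℝ) : Prop :=
  ∃ (gc : Y → Y →L[ℝ] Y →L[ℝ] ℝ) (Q : LinearMap.BilinForm ℝ V),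
    (∀ y v w : V, g y v w = gc (ι y) (ι v) (ι w) + Q v w) ∧
    -- the compact part is symmetric and bounded from above
    (∀ (y : Y) (v w : V), gc y (ι v) (ι w) = gc y (ι w) (ι v)) ∧
    (∃ C : ℝ, ∀ (y : Y) (v : V), gc y (ι v) (ι v) ≤ C * ‖ι v‖ ^ 2) ∧
    -- the compact part is twice differentiable in the position, with bounded derivatives
    TwiceDifferentiableBounded gc ∧
    -- the quadratic part is symmetric, positive semi-definite and bounded
    (∀ v w : V, Q v w = Q w v) ∧ (∀ v : V, 0 ≤ Q v v) ∧
    (∃ C : ℝ, ∀ v : V, Q v v ≤ C * ‖v‖ ^ 2) ∧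
    -- uniform coercivity of the extended metric
    (∃ c : ℝ, 0 < c ∧ ∀ (y : Y) (v : V), c * ‖v‖ ^ 2 ≤ gc y (ι v) (ι v) + Q v v)

/-- The defining relation `u = Γ_y(v, w)` of the Christoffel operator. -/
def IsChristoffel (g : V → V →L[ℝ] V →L[ℝ] ℝ) (y v w u : V) : Prop :=
  ∀ z : V, 2 * g y u z =
    fderiv ℝ g y w v z - fderiv ℝ g y z v w + fderiv ℝ g y v w z

/-- The Christoffel operator `Γ_y(v, w)`. -/
def christoffel (g : V → V →L[ℝ] V →L[ℝ] ℝ) (y v w : V) : V :=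
  Classical.epsilon (IsChristoffel g y v w)

/-- The defining relation of the Christoffel operator is uniquely solvable for a coercive metric. -/
theorem existsUnique_isChristoffel [CompleteSpace V] {g : V → V →L[ℝ] V →L[ℝ] ℝ} {y : V} {c : ℝ}
    (hc : 0 < c) (hg : ∀ v : V, c * ‖v‖ ^ 2 ≤ g y v v) (v w : V) :
    ∃! u : V, IsChristoffel g y v w u := by
  have hco : IsCoercive (g y) := ⟨c, hc, fun u => by
    have := hg u
    rwa [pow_two, ← mul_assoc] at this⟩
  let l : V →L[ℝ] ℝ := (1 / 2 : ℝ) •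
    (fderiv ℝ g y w v - ((fderiv ℝ g y).flip v).flip w + fderiv ℝ g y v w)
  have hl : ∀ z, 2 * l z = fderiv ℝ g y w v z - fderiv ℝ g y z v w + fderiv ℝ g y v w z := by
    intro z
    simp [l]
    ring
  refine ⟨hco.continuousLinearEquivOfBilin.symm ((InnerProductSpace.toDual ℝ V).symm l), ?_, ?_⟩
  · intro z
    rw [← hl z, ← hco.continuousLinearEquivOfBilin_apply]
    simp
  · intro u hu
    rw [ContinuousLinearEquiv.eq_symm_apply]
    refine ext_inner_right ℝ fun z => ?_
    rw [hco.continuousLinearEquivOfBilin_apply, InnerProductSpace.toDual_symm_apply]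
    have h1 := hu z
    have h2 := hl z
    linarith

theorem isChristoffel_christoffel [CompleteSpace V] {ι : V →L[ℝ] Y}
    {g : V → V →L[ℝ] V →L[ℝ] ℝ} (hg : IsAdmissibleMetric ι g) (y v w : V) :
    IsChristoffel g y v w (christoffel g y v w) := by
  obtain ⟨gc, Q, h, -, -, -, -, -, -, c, hc, hco⟩ := hg
  refine Classical.epsilon_spec
    (existsUnique_isChristoffel hc (fun u => ?_) v w).exists
  rw [h]
  exact hco _ _

end Metric

section Curves

variable {V : Type*} [NormedAddCommGroup V] [InnerProductSpace ℝ V]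

/-- `u'` is a weak derivative of `u` on `(0,1)`. -/
def HasWeakDeriv (u u' : ℝ → V) : Prop :=
  ∀ φ : ℝ → ℝ, ContDiff ℝ ∞ φ → HasCompactSupport φ → tsupport φ ⊆ Ioo 0 1 →
    ∫ t in Ioo (0 : ℝ) 1, deriv φ t • u t = -∫ t in Ioo (0 : ℝ) 1, φ t • u' t

/-- The space `L²((0,1); V)`. -/
def MemL2 (u : ℝ → V) : Prop := MemLp u 2 (volume.restrict (Ioo (0 : ℝ) 1))

/-- The Sobolev space `W^{2,2}((0,1); V)`, each class being represented by the curve that is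
continuous on `[0,1]`. Values outside `[0,1]` are irrelevant. -/
def MemW22 (y : ℝ → V) : Prop :=
  ContinuousOn y (Icc 0 1) ∧ MemL2 y ∧
    ∃ u v : ℝ → V, MemL2 u ∧ MemL2 v ∧ HasWeakDeriv y u ∧ HasWeakDeriv u v

/-- The velocity of a `W^{2,2}` curve (which is `C¹` on `[0,1]`); one-sided at the end points. -/
def velocity (y : ℝ → V) : ℝ → V := derivWithin y (Icc 0 1)

/-- The acceleration of a `W^{2,2}` curve: the weak derivative in `L²` of its velocity, which is
unique up to null sets. -/
def acceleration (y : ℝ → V) : ℝ → V :=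
  Classical.epsilon fun a => MemL2 a ∧ HasWeakDeriv (velocity y) a

/-- The covariant derivative along `y` of its velocity field. -/
def covAcceleration (g : V → V →L[ℝ] V →L[ℝ] ℝ) (y : ℝ → V) (t : ℝ) : V :=
  acceleration y t + christoffel g (y t) (velocity y t) (velocity y t)

/-- The path energy. -/
def pathEnergy (g : V → V →L[ℝ] V →L[ℝ] ℝ) (y : ℝ → V) : ℝ :=
  ∫ t in Ioo (0 : ℝ) 1, g (y t) (velocity y t) (velocity y t)

/-- The spline energy. -/
def splineEnergy (g : V → V →L[ℝ] V →L[ℝ] ℝ) (y : ℝ → V) : ℝ :=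
  ∫ t in Ioo (0 : ℝ) 1, g (y t) (covAcceleration g y t) (covAcceleration g y t)

/-- The regularized spline energy. -/
def regSplineEnergy (g : V → V →L[ℝ] V →L[ℝ] ℝ) (σ : ℝ) (y : ℝ → V) : ℝ :=
  splineEnergy g y + σ * pathEnergy g y

/-- The three types of boundary conditions, with the data of the Hermite condition. -/
inductive BoundaryCondition (V : Type*) where
  | natural : BoundaryCondition V
  | hermite (v₀ v₁ : V) : BoundaryCondition V
  | periodic : BoundaryCondition V

/-- The boundary condition holds for the curve `y`. The natural boundary condition imposes nothing
on the competitors: it is the condition that minimizers satisfy when none is imposed. -/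
def BoundaryCondition.Holds : BoundaryCondition V → (ℝ → V) → Prop
  | .natural, _ => True
  | .hermite v₀ v₁, y => velocity y 0 = v₀ ∧ velocity y 1 = v₁
  | .periodic, y => y 0 = y 1 ∧ velocity y 0 = velocity y 1

/-- Standing assumption on the interpolation times `t 0 < ⋯ < t n` under each boundary condition:
for Hermite both end points of `[0,1]` are interpolation times, for periodic not both are. -/
def BoundaryCondition.Compatible {n : ℕ} (t : Fin (n + 1) → ℝ) : BoundaryCondition V → Prop
  | .natural => True
  | .hermite _ _ => t 0 = 0 ∧ t (Fin.last n) = 1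
  | .periodic => t 0 ≠ 0 ∨ t (Fin.last n) ≠ 1

/-- The `W^{2,2}` curves satisfying the interpolation constraints and the boundary condition. -/
def IsCompetitor {n : ℕ} (t : Fin (n + 1) → ℝ) (p : Fin (n + 1) → V) (bc : BoundaryCondition V)
    (y : ℝ → V) : Prop :=
  MemW22 y ∧ (∀ i, y (t i) = p i) ∧ bc.Holds y

/-- Spline interpolations: minimizers of the regularized spline energy among the competitors. -/
def IsSplineInterpolation (g : V → V →L[ℝ] V →L[ℝ] ℝ) (σ : ℝ) {n : ℕ} (t : Fin (n + 1) → ℝ)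
    (p : Fin (n + 1) → V) (bc : BoundaryCondition V) (y : ℝ → V) : Prop :=
  IsCompetitor t p bc y ∧
    ∀ z : ℝ → V, IsCompetitor t p bc z → regSplineEnergy g σ y ≤ regSplineEnergy g σ z

/-- The Hölder space `C^{k,α}([a,b]; V)` on a compact interval. -/
def MemHolderSpace (k : ℕ) (α : NNReal) (a b : ℝ) (y : ℝ → V) : Prop :=
  ContDiffOn ℝ k y (Icc a b) ∧
    ∃ C : NNReal, HolderOnWith C α (iteratedDerivWithin k y (Icc a b)) (Icc a b)

end Curves

end RiemannianSpline

end

/-!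
A curve in `W^{2,2}` is determined by its initial position `a`, its initial velocity `b` and its
acceleration `w` in `L²`: it is the double primitive `pos a b w` (`MemW22.exists_eqOn_pos`). In these
coordinates interpolation and boundary conditions are affine and weakly closed, and everything known
about the metric is collected in `MetricBounds`: uniform coercivity and boundedness, and Lipschitz
dependence of `g` and of its derivative on the position, measured in the norm of `Y`. As a
consequence the Christoffel operator grows quadratically in the velocity and is locally Lipschitz in
position and velocity with respect to the norm of `Y` (`MetricBounds.exists_christoffel_lip`).

*Existence* is the direct method. Competitors exist by Hermite interpolation
(`exists_isCompetitor`). On a sublevel set of the energy the velocity is bounded in `L²`, because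
`σ > 0`, and the covariant acceleration is bounded in `L²`; as the Christoffel term is quadratic in
the velocity, the acceleration is bounded in `L¹`, so the velocity is bounded uniformly, and then the
acceleration is bounded in `L²` (`MetricBounds.exists_bound`). A minimizing sequence therefore has a
weakly convergent subsequence. By compactness of the embedding, positions and velocities converge
pointwise in `Y`, so the Christoffel terms converge strongly, the covariant accelerations converge
weakly, and convexity of `g` in the field gives lower semicontinuity
(`MetricBounds.fieldEnergy_lowerBound`, `MetricBounds.energy_lowerBound`).

*Regularity.* Let `u` be the covariant acceleration of a minimizer. Vary the minimizer by a curve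
`φ` that vanishes at the nodes and vanishes with its derivative at both end points. All first order
terms in the variation of the energy, except `2 ∫ g(u, φ'')`, contain only `φ` and `φ'`, so that
`|∫ g(u, φ'')| ≤ K ‖φ'‖` in `L²` (`MetricBounds.exists_weak_bound`). Since one-sided bounds for
both signs of the parameter suffice, the energy need not be differentiated. By the theorems of
Hahn–Banach and Riesz the left-hand integral equals `∫ ⟪h, φ'⟫` with `h` in `L²`, and integration by
parts turns it into `∫ ⟪P, φ''⟫` with a primitive `P` of `-h`. The constraints on `φ` are finitely
many moment conditions on `φ''`, so the covector field `g(u, ·)` differs from `P` by a combination of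
the weights `1` and `max (τ - s) 0`, which are the Lagrange multipliers
(`exists_ae_eq_sum_of_moments`). Primitives of `L²` functions are Hölder continuous with exponent
`1/2`, hence so is `g(u, ·)` (`exists_holderHalf_of_weak_bound`). Coercivity transfers this to `u`,
and subtracting the Christoffel term transfers it to the acceleration
(`MetricBounds.exists_holderHalf_acceleration`), in fact on all of `[0,1]`.
-/

noncomputable section

open Filter Topology

namespace RiemannianSpline

/-! ### Curves with prescribed initial data and second derivative -/

/-- Lebesgue measure on the open unit interval. -/
abbrev unitMeasure : Measure ℝ := volume.restrict (Ioo (0 : ℝ) 1)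

section Primitive

variable {V : Type*} [NormedAddCommGroup V] [NormedSpace ℝ V]

theorem ae_unitMeasure_mem : ∀ᵐ t ∂unitMeasure, t ∈ Ioo (0 : ℝ) 1 :=
  ae_restrict_mem measurableSet_Ioo

omit [NormedSpace ℝ V] in
theorem MemL2.integrable {w : ℝ → V}
    (hw : MemL2 w) : Integrable w unitMeasure :=
  MemLp.integrable (q := 2) one_le_two hw

/-- On `[0,1]` interval integrals for `unitMeasure` are the usual ones. -/
theorem intervalIntegral_unitMeasure (w : ℝ → V) {s t : ℝ} (hs : s ∈ Icc (0 : ℝ) 1)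
    (ht : t ∈ Icc (0 : ℝ) 1) : ∫ x in s..t, w x ∂unitMeasure = ∫ x in s..t, w x := by
  wlog hst : s ≤ t generalizing s t
  · rw [intervalIntegral.integral_symm, this ht hs (le_of_not_ge hst),
      ← intervalIntegral.integral_symm]
  rw [intervalIntegral.integral_of_le hst, intervalIntegral.integral_of_le hst,
    integral_Ioc_eq_integral_Ioo, integral_Ioc_eq_integral_Ioo,
    Measure.restrict_restrict measurableSet_Ioo,
    inter_eq_left.mpr (Ioo_subset_Ioo hs.1 ht.2)]

/-- The primitive of `w` on `(0,1)` with initial value `b`. Integrating against `unitMeasure` amounts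
to extending `w` by zero, so that the primitive is defined and continuous on the real line. -/
def vel (b : V) (w : ℝ → V) (t : ℝ) : V := b + ∫ s in (0 : ℝ)..t, w s ∂unitMeasure

/-- The curve with initial position `a`, initial velocity `b` and second derivative `w`. -/
def pos (a b : V) (w : ℝ → V) (t : ℝ) : V := a + ∫ s in (0 : ℝ)..t, vel b w s

theorem vel_zero (b : V) (w : ℝ → V) : vel b w 0 = b := by simp [vel]

theorem pos_zero (a b : V) (w : ℝ → V) : pos a b w 0 = a := by simp [pos]

theorem vel_one (b : V) (w : ℝ → V) : vel b w 1 = b + ∫ s, w s ∂unitMeasure := by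
  rw [vel, intervalIntegral.integral_of_le zero_le_one, Measure.restrict_restrict
    measurableSet_Ioc, inter_eq_right.mpr Ioo_subset_Ioc_self]

theorem continuous_vel {b : V} {w : ℝ → V} (hw : Integrable w unitMeasure) :
    Continuous (vel b w) :=
  continuous_const.add (hw.continuous_primitive 0)

theorem vel_congr {b : V} {w w' : ℝ → V} (h : w =ᵐ[unitMeasure] w') : vel b w = vel b w' := by
  funext t
  rw [vel, vel, intervalIntegral.integral_congr_ae_restrict]
  exact ae_restrict_of_ae h

theorem pos_congr {a b : V} {w w' : ℝ → V} (h : w =ᵐ[unitMeasure] w') : pos a b w = pos a b w' := by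
  funext t
  rw [pos, pos, vel_congr h]

theorem vel_add (b b' : V) {w w' : ℝ → V} (hw : Integrable w unitMeasure)
    (hw' : Integrable w' unitMeasure) (t : ℝ) :
    vel (b + b') (fun s => w s + w' s) t = vel b w t + vel b' w' t := by
  rw [vel, vel, vel, intervalIntegral.integral_add hw.intervalIntegrable hw'.intervalIntegrable]
  abel

theorem vel_smul (ε : ℝ) (b : V) (w : ℝ → V) (t : ℝ) :
    vel (ε • b) (fun s => ε • w s) t = ε • vel b w t := by
  rw [vel, vel, intervalIntegral.integral_smul, smul_add]

theorem pos_add (a a' b b' : V) {w w' : ℝ → V} (hw : Integrable w unitMeasure)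
    (hw' : Integrable w' unitMeasure) (t : ℝ) :
    pos (a + a') (b + b') (fun s => w s + w' s) t = pos a b w t + pos a' b' w' t := by
  simp only [pos, vel_add b b' hw hw']
  rw [intervalIntegral.integral_add ((continuous_vel hw).intervalIntegrable _ _)
    ((continuous_vel hw').intervalIntegrable _ _)]
  abel

theorem pos_smul (ε : ℝ) (a b : V) (w : ℝ → V) (t : ℝ) :
    pos (ε • a) (ε • b) (fun s => ε • w s) t = ε • pos a b w t := by
  simp only [pos, vel_smul]
  rw [intervalIntegral.integral_smul, smul_add]

theorem norm_primitive_le {w : ℝ → V} (hw : Integrable w unitMeasure) (s t : ℝ) :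
    ‖∫ x in s..t, w x ∂unitMeasure‖ ≤ ∫ x, ‖w x‖ ∂unitMeasure := by
  refine intervalIntegral.norm_integral_le_integral_norm_uIoc.trans ?_
  exact setIntegral_le_integral hw.norm (Eventually.of_forall fun x => norm_nonneg _)

theorem norm_vel_le (b : V) {w : ℝ → V} (hw : Integrable w unitMeasure) (t : ℝ) :
    ‖vel b w t‖ ≤ ‖b‖ + ∫ x, ‖w x‖ ∂unitMeasure :=
  (norm_add_le _ _).trans (add_le_add_right (norm_primitive_le hw 0 t) _)

theorem vel_sub_vel (b : V) {w : ℝ → V} (hw : Integrable w unitMeasure) (s t : ℝ) :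
    vel b w t - vel b w s = ∫ x in s..t, w x ∂unitMeasure := by
  rw [vel, vel, add_sub_add_left_eq_sub,
    intervalIntegral.integral_interval_sub_left hw.intervalIntegrable hw.intervalIntegrable]

theorem pos_eq_vel (a b : V) {w : ℝ → V} {t : ℝ} (ht : t ∈ Icc (0 : ℝ) 1) :
    pos a b w t = vel a (vel b w) t := by
  rw [vel, intervalIntegral_unitMeasure _ (left_mem_Icc.mpr zero_le_one) ht, pos]

omit [NormedSpace ℝ V] in
theorem memL2_of_continuous {u : ℝ → V} (hu : Continuous u) : MemL2 u := by
  obtain ⟨C, hC⟩ := (isCompact_Icc (a := (0 : ℝ)) (b := 1)).exists_bound_of_continuousOn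
    hu.continuousOn
  refine MemLp.of_bound hu.aestronglyMeasurable C ?_
  filter_upwards [ae_unitMeasure_mem] with t ht using hC t (Ioo_subset_Icc_self ht)

omit [NormedSpace ℝ V] in
/-- Continuous functions on `[0,1]` that agree almost everywhere agree. -/
theorem eqOn_Icc_of_ae_eq {u v : ℝ → V} (hu : ContinuousOn u (Icc 0 1))
    (hv : ContinuousOn v (Icc 0 1)) (h : u =ᵐ[unitMeasure] v) : EqOn u v (Icc 0 1) := by
  have h1 : EqOn u v (Ioo 0 1) := Measure.eqOn_open_of_ae_eq h isOpen_Ioo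
    (hu.mono Ioo_subset_Icc_self) (hv.mono Ioo_subset_Icc_self)
  exact h1.of_subset_closure hu hv Ioo_subset_Icc_self (closure_Ioo zero_ne_one).ge

variable [CompleteSpace V]

theorem hasDerivAt_pos (a : V) {b : V} {w : ℝ → V} (hw : Integrable w unitMeasure) (t : ℝ) :
    HasDerivAt (pos a b w) (vel b w t) t :=
  ((continuous_vel hw).integral_hasStrictDerivAt 0 t).hasDerivAt.const_add a

theorem continuous_pos {a b : V} {w : ℝ → V} (hw : Integrable w unitMeasure) :
    Continuous (pos a b w) :=
  continuous_iff_continuousAt.mpr fun t => (hasDerivAt_pos a hw t).continuousAt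

/-- Fubini's theorem on the triangle `s < t`, for a bilinear pairing. -/
theorem integral_bilin_primitive {E F G : Type*} [NormedAddCommGroup E] [NormedSpace ℝ E]
    [CompleteSpace E] [NormedAddCommGroup F] [NormedSpace ℝ F] [CompleteSpace F]
    [NormedAddCommGroup G] [NormedSpace ℝ G] [CompleteSpace G] (B : E →L[ℝ] F →L[ℝ] G)
    {f : ℝ → E} {w : ℝ → F} (hf : Integrable f unitMeasure) (hw : Integrable w unitMeasure) :
    ∫ t, B (f t) (∫ s in (0 : ℝ)..t, w s ∂unitMeasure) ∂unitMeasure =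
      ∫ s, B (∫ t in s..1, f t ∂unitMeasure) (w s) ∂unitMeasure := by
  have hint : Integrable (Function.uncurry fun t s =>
      {x : ℝ × ℝ | x.2 < x.1}.indicator (fun x => B (f x.1) (w x.2)) (t, s))
      (unitMeasure.prod unitMeasure) := by
    refine Integrable.indicator ?_ (measurableSet_lt measurable_snd measurable_fst)
    refine Integrable.op_fst_snd (op := fun x y => B x y) ?_
      ⟨‖B‖, fun x y => B.le_opNorm₂ x y⟩ hf hw
    exact B.continuous₂
  have h1 : ∀ᵐ t ∂unitMeasure, B (f t) (∫ s in (0 : ℝ)..t, w s ∂unitMeasure) =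
      ∫ s, {x : ℝ × ℝ | x.2 < x.1}.indicator (fun x => B (f x.1) (w x.2)) (t, s) ∂unitMeasure := by
    filter_upwards [ae_unitMeasure_mem] with t ht
    rw [intervalIntegral.integral_of_le ht.1.le, integral_Ioc_eq_integral_Ioo,
      ← ContinuousLinearMap.integral_comp_comm _ hw.integrableOn, ← integral_indicator
      measurableSet_Ioo]
    refine integral_congr_ae ?_
    filter_upwards [ae_unitMeasure_mem] with s hs
    by_cases h : s < t <;> simp [indicator, h, hs.1]
  have h2 : ∀ᵐ s ∂unitMeasure, B (∫ t in s..1, f t ∂unitMeasure) (w s) =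
      ∫ t, {x : ℝ × ℝ | x.2 < x.1}.indicator (fun x => B (f x.1) (w x.2)) (t, s) ∂unitMeasure := by
    filter_upwards [ae_unitMeasure_mem] with s hs
    rw [intervalIntegral.integral_of_le hs.2.le,
      ← ContinuousLinearMap.flip_apply B, ← ContinuousLinearMap.integral_comp_comm _
      hf.integrableOn, ← integral_indicator measurableSet_Ioc]
    refine integral_congr_ae ?_
    filter_upwards [ae_unitMeasure_mem] with t ht
    by_cases h : s < t <;> simp [indicator, h, ht.2.le]
  rw [integral_congr_ae h1, integral_congr_ae h2]
  exact integral_integral_swap hint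

end Primitive

section Weak

variable {V : Type*} [NormedAddCommGroup V] [InnerProductSpace ℝ V]

theorem integrable_testFunction {φ : ℝ → ℝ} (hφ : Continuous φ) (hc : HasCompactSupport φ) :
    Integrable φ unitMeasure :=
  (hφ.integrable_of_hasCompactSupport hc).restrict

theorem integrable_testFunction_smul {φ : ℝ → ℝ} (hφ : Continuous φ) (hc : HasCompactSupport φ)
    {u : ℝ → V} (hu : Integrable u unitMeasure) :
    Integrable (fun t => φ t • u t) unitMeasure := by
  obtain ⟨C, hC⟩ := hφ.bounded_above_of_compact_support hc
  exact hu.bdd_smul C hφ.aestronglyMeasurable (Eventually.of_forall hC)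

theorem testFunction_eq_zero {φ : ℝ → ℝ} (hs : tsupport φ ⊆ Ioo 0 1) {t : ℝ}
    (ht : t ∉ Ioo (0 : ℝ) 1) : φ t = 0 :=
  image_eq_zero_of_notMem_tsupport fun h => ht (hs h)

theorem integral_deriv_testFunction {φ : ℝ → ℝ} (hφ : ContDiff ℝ ∞ φ) {s t : ℝ}
    (hs : s ∈ Icc (0 : ℝ) 1) (ht : t ∈ Icc (0 : ℝ) 1) :
    ∫ x in s..t, deriv φ x ∂unitMeasure = φ t - φ s := by
  rw [intervalIntegral_unitMeasure _ hs ht]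
  exact intervalIntegral.integral_deriv_eq_sub
    (fun x _ => (hφ.differentiable (by simp)).differentiableAt)
    ((hφ.continuous_deriv (by simp)).intervalIntegrable _ _)

variable [CompleteSpace V]

theorem hasWeakDeriv_vel (b : V) {w : ℝ → V} (hw : Integrable w unitMeasure) :
    HasWeakDeriv (vel b w) w := by
  intro φ hφ hc hs
  have hd : Continuous (deriv φ) := hφ.continuous_deriv (by simp)
  have h01 : (0 : ℝ) ∈ Icc (0 : ℝ) 1 := left_mem_Icc.mpr zero_le_one
  have h11 : (1 : ℝ) ∈ Icc (0 : ℝ) 1 := right_mem_Icc.mpr zero_le_one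
  have hφ0 : φ 0 = 0 := testFunction_eq_zero hs (by simp)
  have hφ1 : φ 1 = 0 := testFunction_eq_zero hs (by simp)
  have hi := integrable_testFunction hd hc.deriv
  have hmain := integral_bilin_primitive (ContinuousLinearMap.lsmul ℝ ℝ : ℝ →L[ℝ] V →L[ℝ] V) hi hw
  simp only [ContinuousLinearMap.lsmul_apply] at hmain
  have hp : Integrable (fun t => deriv φ t • ∫ s in (0 : ℝ)..t, w s ∂unitMeasure) unitMeasure :=
    integrable_testFunction_smul hd hc.deriv
      (memL2_of_continuous (hw.continuous_primitive 0)).integrable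
  have hz : ∫ t, deriv φ t ∂unitMeasure = 0 := by
    have h := vel_one 0 (deriv φ)
    rw [vel, zero_add, zero_add, integral_deriv_testFunction hφ h01 h11, hφ0, hφ1, sub_zero] at h
    exact h.symm
  simp only [vel, smul_add]
  rw [integral_add (hi.smul_const b) hp, integral_smul_const, hz, zero_smul, zero_add, hmain,
    ← integral_neg]
  refine integral_congr_ae ?_
  filter_upwards [ae_unitMeasure_mem] with s hs'
  rw [integral_deriv_testFunction hφ (Ioo_subset_Icc_self hs') h11, hφ1, zero_sub, neg_smul]

/-- The primitive of a test function with mean zero is a test function. -/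
theorem exists_testFunction_primitive {φ : ℝ → ℝ} (hφ : ContDiff ℝ ∞ φ)
    (hc : HasCompactSupport φ) (hs : tsupport φ ⊆ Ioo 0 1)
    (h0 : ∫ t, φ t ∂unitMeasure = 0) :
    ∃ ψ : ℝ → ℝ, ContDiff ℝ ∞ ψ ∧ HasCompactSupport ψ ∧ tsupport ψ ⊆ Ioo 0 1 ∧ deriv ψ = φ := by
  have hd : ∀ t, HasDerivAt (fun t => ∫ s in (0 : ℝ)..t, φ s) (φ t) t := fun t =>
    (hφ.continuous.integral_hasStrictDerivAt 0 t).hasDerivAt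
  have hderiv : deriv (fun t => ∫ s in (0 : ℝ)..t, φ s) = φ := funext fun t => (hd t).deriv
  obtain ⟨α, β, hα, hβ, hαβ⟩ : ∃ α β : ℝ, 0 < α ∧ β < 1 ∧ tsupport φ ⊆ Icc α β := by
    rcases (tsupport φ).eq_empty_or_nonempty with he | hne
    · exact ⟨1, 0, one_pos, one_pos, by simp [he]⟩
    · have hK : IsCompact (tsupport φ) := hc
      exact ⟨sInf (tsupport φ), sSup (tsupport φ), (hs (hK.sInf_mem hne)).1,
        (hs (hK.sSup_mem hne)).2,
        fun x hx => ⟨csInf_le hK.bddBelow hx, le_csSup hK.bddAbove hx⟩⟩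
  have hz : ∀ t, t ∉ Icc α β → φ t = 0 := fun t ht =>
    image_eq_zero_of_notMem_tsupport fun h => ht (hαβ h)
  have h01 : ∫ s in (0 : ℝ)..1, φ s = 0 := by
    have := vel_one 0 φ
    rwa [vel, zero_add, zero_add, h0, intervalIntegral_unitMeasure φ (left_mem_Icc.mpr zero_le_one)
      (right_mem_Icc.mpr zero_le_one)] at this
  have hsupp : Function.support (fun t => ∫ s in (0 : ℝ)..t, φ s) ⊆ Icc α β := by
    intro t ht
    by_contra hcon
    apply ht
    rw [mem_Icc, not_and_or, not_le, not_le] at hcon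
    rcases hcon with h | h
    · refine intervalIntegral.integral_zero_ae (Eventually.of_forall fun s hs' => hz s fun hm => ?_)
      have : s ≤ max 0 t := hs'.2
      exact absurd (hm.1.trans this) (not_le.mpr (max_lt hα h))
    · have h1 : ∫ s in t..1, φ s = 0 := by
        refine intervalIntegral.integral_zero_ae
          (Eventually.of_forall fun s hs' => hz s fun hm => ?_)
        have : min t 1 < s := hs'.1
        exact absurd (this.trans_le hm.2) (not_lt.mpr (le_min h.le hβ.le))
      have := intervalIntegral.integral_add_adjacent_intervals
        (hφ.continuous.intervalIntegrable (μ := volume) 0 t)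
        (hφ.continuous.intervalIntegrable (μ := volume) t 1)
      rw [h1, add_zero, h01] at this
      exact this
  have hts := closure_minimal hsupp isClosed_Icc
  refine ⟨_, contDiff_infty_iff_deriv.mpr ⟨fun t => (hd t).differentiableAt, by rwa [hderiv]⟩,
    HasCompactSupport.of_support_subset_isCompact isCompact_Icc hsupp, ?_, hderiv⟩
  exact fun x hx => ⟨hα.trans_le (hts hx).1, (hts hx).2.trans_lt hβ⟩

/-- A test function with integral one. -/
theorem exists_testFunction_integral_one :
    ∃ η : ℝ → ℝ, ContDiff ℝ ∞ η ∧ HasCompactSupport η ∧ tsupport η ⊆ Ioo 0 1 ∧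
      ∫ t, η t ∂unitMeasure = 1 := by
  let f : ContDiffBump (1 / 2 : ℝ) := ⟨1 / 8, 1 / 4, by norm_num, by norm_num⟩
  have hts : tsupport (f.normed volume) ⊆ Ioo 0 1 := by
    rw [f.tsupport_normed_eq, Real.closedBall_eq_Icc]
    exact fun x hx => ⟨by have := hx.1; norm_num [f] at this; linarith,
      by have := hx.2; norm_num [f] at this; linarith⟩
  refine ⟨f.normed volume, f.contDiff_normed, f.hasCompactSupport_normed, hts, ?_⟩
  rw [setIntegral_eq_integral_of_forall_compl_eq_zero fun t ht => testFunction_eq_zero hts ht]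
  exact f.integral_normed

/-- The lemma of du Bois-Reymond: a function with vanishing weak derivative is constant. -/
theorem ae_eq_const_of_hasWeakDeriv_zero {u : ℝ → V} (hu : Integrable u unitMeasure)
    (h : HasWeakDeriv u fun _ => 0) : ∃ b : V, ∀ᵐ t ∂unitMeasure, u t = b := by
  obtain ⟨η, hη, hηc, hηs, hη1⟩ := exists_testFunction_integral_one
  refine ⟨∫ t, η t • u t ∂unitMeasure, ?_⟩
  set b := ∫ t, η t • u t ∂unitMeasure with hb
  have key := isOpen_Ioo.ae_eq_zero_of_integral_contDiff_smul_eq_zero (U := Ioo (0 : ℝ) 1)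
    (f := fun t => u t - b) (μ := volume)
    ((IntegrableOn.locallyIntegrableOn (μ := volume) (hu.sub (integrable_const b)))) ?_
  · rw [ae_restrict_iff' measurableSet_Ioo]
    filter_upwards [key] with t ht ht' using sub_eq_zero.mp (ht ht')
  intro φ hφ hφc hφs
  have hφi := integrable_testFunction hφ.continuous hφc
  have hηi := integrable_testFunction hη.continuous hηc
  set m := ∫ t, φ t ∂unitMeasure with hm
  have hts : tsupport (fun t => φ t - m * η t) ⊆ Ioo 0 1 := by
    refine (tsupport_sub φ fun t => m * η t).trans (union_subset hφs ?_)
    exact (tsupport_mul_subset_right (f := fun _ => m) (g := η)).trans hηs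
  obtain ⟨ψ, hψ, hψc, hψs, hψd⟩ := exists_testFunction_primitive
    (φ := fun t => φ t - m * η t) (hφ.sub (contDiff_const.mul hη))
    (hφc.sub hηc.mul_left) hts (by
      rw [integral_sub hφi (hηi.const_mul m), integral_const_mul, hη1, mul_one, sub_self])
  have h1 := h ψ hψ hψc hψs
  rw [hψd] at h1
  simp only [smul_zero, integral_zero, neg_zero, sub_smul, mul_smul] at h1
  have hφu := integrable_testFunction_smul hφ.continuous hφc hu
  have hηu := integrable_testFunction_smul hη.continuous hηc hu
  have hηu' : Integrable (fun t => m • η t • u t) unitMeasure := hηu.smul m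
  rw [integral_sub hφu hηu', integral_smul, ← hb] at h1
  rw [← setIntegral_eq_integral_of_forall_compl_eq_zero (s := Ioo (0 : ℝ) 1)
    fun t ht => by rw [testFunction_eq_zero hφs ht, zero_smul]]
  simp only [smul_sub]
  rw [integral_sub hφu (hφi.smul_const b), integral_smul_const, ← hm, h1]

theorem ae_eq_vel_of_hasWeakDeriv {u w : ℝ → V} (hu : Integrable u unitMeasure)
    (hw : Integrable w unitMeasure) (h : HasWeakDeriv u w) :
    ∃ b : V, u =ᵐ[unitMeasure] vel b w := by
  have hv := (memL2_of_continuous (continuous_vel (b := (0 : V)) hw)).integrable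
  obtain ⟨b, hb⟩ := ae_eq_const_of_hasWeakDeriv_zero (u := fun t => u t - vel 0 w t)
    (hu.sub hv) (fun φ hφ hc hs => by
      have hd : Continuous (deriv φ) := hφ.continuous_deriv (by simp)
      simp only [smul_sub, smul_zero, integral_zero, neg_zero]
      rw [integral_sub (integrable_testFunction_smul hd hc.deriv hu)
        (integrable_testFunction_smul hd hc.deriv hv), h φ hφ hc hs,
        hasWeakDeriv_vel 0 hw φ hφ hc hs, sub_self])
  refine ⟨b, ?_⟩
  filter_upwards [hb] with t ht
  rw [sub_eq_iff_eq_add.mp ht, vel, vel, zero_add]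

theorem HasWeakDeriv.ae_unique {u w w' : ℝ → V} (hw : Integrable w unitMeasure)
    (hw' : Integrable w' unitMeasure) (h : HasWeakDeriv u w) (h' : HasWeakDeriv u w') :
    w =ᵐ[unitMeasure] w' := by
  have key := isOpen_Ioo.ae_eq_zero_of_integral_contDiff_smul_eq_zero (U := Ioo (0 : ℝ) 1)
    (f := fun t => w t - w' t) (μ := volume)
    ((IntegrableOn.locallyIntegrableOn (μ := volume) (hw.sub hw'))) ?_
  · rw [Filter.EventuallyEq, ae_restrict_iff' measurableSet_Ioo]
    filter_upwards [key] with t ht ht' using sub_eq_zero.mp (ht ht')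
  intro φ hφ hc hs
  rw [← setIntegral_eq_integral_of_forall_compl_eq_zero (s := Ioo (0 : ℝ) 1)
    fun t ht => by rw [testFunction_eq_zero hs ht, zero_smul]]
  simp only [smul_sub]
  rw [integral_sub (integrable_testFunction_smul hφ.continuous hc hw)
    (integrable_testFunction_smul hφ.continuous hc hw')]
  rw [sub_eq_zero, ← neg_inj, ← h φ hφ hc hs, ← h' φ hφ hc hs]

/-- Every `W^{2,2}` curve is the double primitive of its second weak derivative. -/
theorem MemW22.exists_eqOn_pos {y : ℝ → V} (hy : MemW22 y) :
    ∃ (a b : V) (w : ℝ → V), MemL2 w ∧ EqOn y (pos a b w) (Icc 0 1) := by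
  obtain ⟨hc, hy2, u, w, hu, hw, hyu, huw⟩ := hy
  obtain ⟨b, hb⟩ := ae_eq_vel_of_hasWeakDeriv hu.integrable hw.integrable huw
  obtain ⟨a, ha⟩ := ae_eq_vel_of_hasWeakDeriv hy2.integrable hu.integrable hyu
  refine ⟨a, b, w, hw, eqOn_Icc_of_ae_eq hc (continuous_pos hw.integrable).continuousOn ?_⟩
  filter_upwards [ha, ae_unitMeasure_mem] with t ht ht'
  rw [ht, pos_eq_vel _ _ (Ioo_subset_Icc_self ht'), vel_congr hb]

theorem memW22_of_eqOn_pos {y : ℝ → V} {a b : V} {w : ℝ → V} (hw : MemL2 w)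
    (h : EqOn y (pos a b w) (Icc 0 1)) : MemW22 y := by
  have hae : ∀ᵐ t ∂unitMeasure, y t = pos a b w t := by
    filter_upwards [ae_unitMeasure_mem] with t ht using h (Ioo_subset_Icc_self ht)
  refine ⟨(continuous_pos hw.integrable).continuousOn.congr h,
    (memLp_congr_ae hae).mpr (memL2_of_continuous (continuous_pos hw.integrable)),
    vel b w, w, memL2_of_continuous (continuous_vel hw.integrable), hw, ?_,
    hasWeakDeriv_vel b hw.integrable⟩
  intro φ hφ hc hs
  rw [← hasWeakDeriv_vel a
    (memL2_of_continuous (continuous_vel (b := b) hw.integrable)).integrable φ hφ hc hs]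
  refine integral_congr_ae ?_
  filter_upwards [hae, ae_unitMeasure_mem] with t ht ht'
  rw [ht, pos_eq_vel _ _ (Ioo_subset_Icc_self ht')]

theorem velocity_eqOn_vel {y : ℝ → V} {a b : V} {w : ℝ → V} (hw : Integrable w unitMeasure)
    (h : EqOn y (pos a b w) (Icc 0 1)) : EqOn (velocity y) (vel b w) (Icc 0 1) := by
  intro t ht
  rw [velocity, derivWithin_congr h (h ht)]
  exact (hasDerivAt_pos a hw t).hasDerivWithinAt.derivWithin
    (uniqueDiffOn_Icc zero_lt_one t ht)

theorem acceleration_ae_eq {y : ℝ → V} {a b : V} {w : ℝ → V} (hw : MemL2 w)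
    (h : EqOn y (pos a b w) (Icc 0 1)) : acceleration y =ᵐ[unitMeasure] w := by
  have hv : HasWeakDeriv (velocity y) w := by
    intro φ hφ hc hs
    rw [← hasWeakDeriv_vel b hw.integrable φ hφ hc hs]
    refine setIntegral_congr_fun measurableSet_Ioo fun t ht => ?_
    simp only [velocity_eqOn_vel hw.integrable h (Ioo_subset_Icc_self ht)]
  have hex : ∃ a : ℝ → V, MemL2 a ∧ HasWeakDeriv (velocity y) a := ⟨w, hw, hv⟩
  obtain ⟨h1, h2⟩ := Classical.epsilon_spec hex
  exact HasWeakDeriv.ae_unique h1.integrable hw.integrable h2 hv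

end Weak

/-! ### Uniform estimates for the metric and the Christoffel operator -/

section Metric

-- the instances on spaces of trilinear forms are found only by a nested search
set_option maxSynthPendingDepth 3

variable {V Y : Type*} [NormedAddCommGroup V] [InnerProductSpace ℝ V]
  [NormedAddCommGroup Y] [NormedSpace ℝ Y]

/-- The quantitative content of admissibility, with one coercivity constant `c` and one constant `M`
for all upper bounds. The metric depends on the position only through its image in `Y`, and its
derivative sees all three arguments only through their images in `Y`, because the part `Q` of the
metric does not depend on the position. -/
structure MetricBounds (ι : V →L[ℝ] Y) (g : V → V →L[ℝ] V →L[ℝ] ℝ) (c M : ℝ) : Prop where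
  c_pos : 0 < c
  M_nonneg : 0 ≤ M
  symm : ∀ y v w, g y v w = g y w v
  coercive : ∀ y v, c * ‖v‖ ^ 2 ≤ g y v v
  bound : ∀ y v w, |g y v w| ≤ M * ‖v‖ * ‖w‖
  lip : ∀ y y' v w, |g y v w - g y' v w| ≤ M * ‖ι y - ι y'‖ * ‖v‖ * ‖w‖
  differentiable : Differentiable ℝ g
  fderiv_bound : ∀ y w v z, |fderiv ℝ g y w v z| ≤ M * ‖ι w‖ * ‖ι v‖ * ‖ι z‖
  fderiv_lip : ∀ y y' w v z, |fderiv ℝ g y w v z - fderiv ℝ g y' w v z| ≤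
    M * ‖ι y - ι y'‖ * ‖ι w‖ * ‖ι v‖ * ‖ι z‖

/-- The pull-back of bilinear forms along `ι`, as a bounded operator. -/
def pullback (ι : V →L[ℝ] Y) : (Y →L[ℝ] Y →L[ℝ] ℝ) →L[ℝ] (V →L[ℝ] V →L[ℝ] ℝ) :=
  LinearMap.mkContinuous
    { toFun := fun b : Y →L[ℝ] Y →L[ℝ] ℝ => (b.bilinearComp ι ι : V →L[ℝ] V →L[ℝ] ℝ)
      map_add' := fun _ _ => rfl
      map_smul' := fun _ _ => rfl } (‖ι‖ * ‖ι‖) fun b => by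
    refine ContinuousLinearMap.opNorm_le_bound₂ _ (by positivity) fun v w => ?_
    calc ‖b (ι v) (ι w)‖ ≤ ‖b‖ * ‖ι v‖ * ‖ι w‖ := b.le_opNorm₂ _ _
      _ ≤ ‖b‖ * (‖ι‖ * ‖v‖) * (‖ι‖ * ‖w‖) := by gcongr <;> exact ι.le_opNorm _
      _ = ‖ι‖ * ‖ι‖ * ‖b‖ * ‖v‖ * ‖w‖ := by ring

theorem pullback_apply (ι : V →L[ℝ] Y) (b : Y →L[ℝ] Y →L[ℝ] ℝ) (v w : V) :
    pullback ι b v w = b (ι v) (ι w) := rfl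

theorem norm_image_sub_le_of_norm_fderiv_le {E F : Type*} [NormedAddCommGroup E] [NormedSpace ℝ E]
    [NormedAddCommGroup F] [NormedSpace ℝ F] {f : E → F} (hf : Differentiable ℝ f) {C : ℝ}
    (hC : ∀ x, ‖fderiv ℝ f x‖ ≤ C) (x y : E) : ‖f x - f y‖ ≤ C * ‖x - y‖ :=
  convex_univ.norm_image_sub_le_of_norm_fderiv_le (fun x _ => hf x) (fun x _ => hC x)
    (mem_univ y) (mem_univ x)

theorem nonneg_of_norm_fderiv_le {E F : Type*} [NormedAddCommGroup E] [NormedSpace ℝ E]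
    [NormedAddCommGroup F] [NormedSpace ℝ F] {f : E → F} {C : ℝ}
    (hC : ∀ x, ‖fderiv ℝ f x‖ ≤ C) : 0 ≤ C :=
  (norm_nonneg _).trans (hC 0)

theorem IsAdmissibleMetric.exists_metricBounds {ι : V →L[ℝ] Y} {g : V → V →L[ℝ] V →L[ℝ] ℝ}
    (hg : IsAdmissibleMetric ι g) : ∃ c M, MetricBounds ι g c M := by
  obtain ⟨gc, Q, h, hsymm, ⟨C, hC⟩, ⟨hd1, hd2, ⟨C₁, hC₁⟩, ⟨C₂, hC₂⟩⟩, hQs, hQp, ⟨C₃, hC₃⟩,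
    c, hc, hco⟩ := hg
  have hC₁0 : 0 ≤ C₁ := nonneg_of_norm_fderiv_le hC₁
  have hC₂0 : 0 ≤ C₂ := nonneg_of_norm_fderiv_le hC₂
  have hgs : ∀ y v w, g y v w = g y w v := fun y v w => by rw [h, h, hsymm, hQs]
  have hgc : ∀ y v, c * ‖v‖ ^ 2 ≤ g y v v := fun y v => by rw [h]; exact hco _ _
  -- the constant part `Q` of the metric is the difference of two bounded forms, hence bounded
  have hsplit : g = fun y => pullback ι (gc (ι y)) + (g 0 - pullback ι (gc (ι 0))) := by
    funext y
    ext v w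
    simp [pullback_apply, h]
  have hfd : ∀ y, HasFDerivAt g ((pullback ι).comp ((fderiv ℝ gc (ι y)).comp ι)) y := by
    intro y
    rw [hsplit]
    exact ((pullback ι).hasFDerivAt.comp y
      ((hd1 (ι y)).hasFDerivAt.comp y ι.hasFDerivAt)).add_const _
  have hfa : ∀ y w v z, fderiv ℝ g y w v z = fderiv ℝ gc (ι y) (ι w) (ι v) (ι z) := by
    intro y w v z
    rw [(hfd y).fderiv]
    rfl
  have h3 : ∀ (A : Y →L[ℝ] Y →L[ℝ] Y →L[ℝ] ℝ) (K : ℝ), ‖A‖ ≤ K → ∀ a b d : Y,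
      |A a b d| ≤ K * ‖a‖ * ‖b‖ * ‖d‖ := by
    intro A K hA a b d
    calc |A a b d| ≤ ‖A a‖ * ‖b‖ * ‖d‖ := (A a).le_opNorm₂ b d
      _ ≤ (K * ‖a‖) * ‖b‖ * ‖d‖ := by
        gcongr
        exact A.le_of_opNorm_le hA a
  set M₀ := |C| * ‖ι‖ ^ 2 + |C₃| with hM₀
  have hub : ∀ y v, g y v v ≤ M₀ * ‖v‖ ^ 2 := by
    intro y v
    have h1 : C * ‖ι v‖ ^ 2 ≤ |C| * (‖ι‖ * ‖v‖) ^ 2 := by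
      gcongr
      · exact le_abs_self C
      · exact ι.le_opNorm v
    have h2 : C₃ * ‖v‖ ^ 2 ≤ |C₃| * ‖v‖ ^ 2 := by gcongr; exact le_abs_self C₃
    calc g y v v = gc (ι y) (ι v) (ι v) + Q v v := h y v v
      _ ≤ |C| * (‖ι‖ * ‖v‖) ^ 2 + |C₃| * ‖v‖ ^ 2 :=
        add_le_add ((hC _ _).trans h1) ((hC₃ v).trans h2)
      _ = M₀ * ‖v‖ ^ 2 := by rw [hM₀]; ring
  have hM₀0 : 0 ≤ M₀ := by positivity
  have hb : ∀ y v w, |g y v w| ≤ M₀ * ‖v‖ * ‖w‖ := by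
    intro y v w
    have hpos : ∀ v, 0 ≤ g y v v := fun v => le_trans (by positivity) (hgc y v)
    have := LinearMap.BilinForm.apply_sq_le_of_symm (g y).toLinearMap₁₂
      (fun v => hpos v) ⟨fun v w => hgs y v w⟩ v w
    simp only [ContinuousLinearMap.toLinearMap₁₂_apply] at this
    refine abs_le_of_sq_le_sq ?_ (by positivity)
    calc (g y v w) ^ 2 ≤ g y v v * g y w w := this
      _ ≤ (M₀ * ‖v‖ ^ 2) * (M₀ * ‖w‖ ^ 2) :=
        mul_le_mul (hub y v) (hub y w) (hpos w) (by positivity)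
      _ = (M₀ * ‖v‖ * ‖w‖) ^ 2 := by ring
  set M := M₀ + C₁ * ‖ι‖ ^ 2 + C₁ + C₂ with hM
  have hi2 : 0 ≤ C₁ * ‖ι‖ ^ 2 := by positivity
  refine ⟨c, M, hc, by positivity, hgs, hgc, fun y v w => (hb y v w).trans ?_, fun y y' v w => ?_,
    fun y => (hfd y).differentiableAt, fun y w v z => ?_, fun y y' w v z => ?_⟩
  · gcongr
    linarith
  · rw [h, h, add_sub_add_right_eq_sub]
    calc |gc (ι y) (ι v) (ι w) - gc (ι y') (ι v) (ι w)|
        ≤ ‖gc (ι y) - gc (ι y')‖ * ‖ι v‖ * ‖ι w‖ := (gc (ι y) - gc (ι y')).le_opNorm₂ _ _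
      _ ≤ (C₁ * ‖ι y - ι y'‖) * (‖ι‖ * ‖v‖) * (‖ι‖ * ‖w‖) := by
        gcongr
        · exact norm_image_sub_le_of_norm_fderiv_le hd1 hC₁ _ _
        · exact ι.le_opNorm _
        · exact ι.le_opNorm _
      _ = (C₁ * ‖ι‖ ^ 2) * ‖ι y - ι y'‖ * ‖v‖ * ‖w‖ := by ring
      _ ≤ M * ‖ι y - ι y'‖ * ‖v‖ * ‖w‖ := by
        gcongr
        linarith
  · rw [hfa]
    refine (h3 _ C₁ (hC₁ _) _ _ _).trans ?_
    gcongr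
    linarith
  · rw [hfa, hfa]
    refine (h3 (fderiv ℝ gc (ι y) - fderiv ℝ gc (ι y')) (C₂ * ‖ι y - ι y'‖)
      (norm_image_sub_le_of_norm_fderiv_le hd2 hC₂ _ _) _ _ _).trans ?_
    gcongr
    linarith

variable {ι : V →L[ℝ] Y} {g : V → V →L[ℝ] V →L[ℝ] ℝ} {c M : ℝ}

namespace MetricBounds

theorem nonneg (h : MetricBounds ι g c M) (y v : V) : 0 ≤ g y v v :=
  le_trans (by have := h.c_pos; positivity) (h.coercive y v)

theorem apply_self_le (h : MetricBounds ι g c M) (y v : V) : g y v v ≤ M * ‖v‖ ^ 2 :=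
  (le_abs_self _).trans ((h.bound y v v).trans_eq (by ring))

/-- A vector that represents through `g y` a functional of norm at most `K` has norm at most
`K / c`. -/
theorem norm_le_of_forall (h : MetricBounds ι g c M) {y u : V} {K : ℝ} (hK : 0 ≤ K)
    (hu : ∀ z, g y u z ≤ K * ‖z‖) : ‖u‖ ≤ K / c := by
  rw [le_div_iff₀ h.c_pos]
  by_contra! hcon
  have h1 := (h.coercive y u).trans (hu u)
  have hu0 : 0 < ‖u‖ := by
    by_contra! h0
    rw [le_antisymm h0 (norm_nonneg u), zero_mul] at hcon
    exact absurd hcon (not_lt.mpr hK)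
  nlinarith

theorem lip_norm (h : MetricBounds ι g c M) (y y' v w : V) :
    |g y v w - g y' v w| ≤ M * ‖ι‖ * ‖y - y'‖ * ‖v‖ * ‖w‖ := by
  have := h.M_nonneg
  refine (h.lip y y' v w).trans ?_
  have h1 : ‖ι y - ι y'‖ ≤ ‖ι‖ * ‖y - y'‖ := by rw [← map_sub]; exact ι.le_opNorm _
  calc M * ‖ι y - ι y'‖ * ‖v‖ * ‖w‖ ≤ M * (‖ι‖ * ‖y - y'‖) * ‖v‖ * ‖w‖ := by gcongr
    _ = M * ‖ι‖ * ‖y - y'‖ * ‖v‖ * ‖w‖ := by ring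

theorem isChristoffel [CompleteSpace V] (h : MetricBounds ι g c M) (y v w : V) :
    IsChristoffel g y v w (christoffel g y v w) :=
  Classical.epsilon_spec (existsUnique_isChristoffel h.c_pos (h.coercive y) v w).exists

theorem two_mul_apply_christoffel [CompleteSpace V] (h : MetricBounds ι g c M) (y v z : V) :
    2 * g y (christoffel g y v v) z = 2 * fderiv ℝ g y v v z - fderiv ℝ g y z v v := by
  rw [h.isChristoffel y v v z]
  ring

theorem norm_christoffel_le [CompleteSpace V] (h : MetricBounds ι g c M) (y v : V) :
    ‖christoffel g y v v‖ ≤ 3 * M * ‖ι‖ ^ 3 / c * ‖v‖ ^ 2 := by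
  have hM := h.M_nonneg
  have key : ∀ z, g y (christoffel g y v v) z ≤ (3 * M * ‖ι‖ ^ 3 * ‖v‖ ^ 2) * ‖z‖ := by
    intro z
    have h1 := h.two_mul_apply_christoffel y v z
    have h2 := (abs_le.mp (h.fderiv_bound y v v z)).2
    have h3 := (abs_le.mp (h.fderiv_bound y z v v)).1
    have h4 : M * ‖ι v‖ * ‖ι v‖ * ‖ι z‖ ≤ M * (‖ι‖ * ‖v‖) * (‖ι‖ * ‖v‖) * (‖ι‖ * ‖z‖) := by
      gcongr <;> exact ι.le_opNorm _
    have h5 : 0 ≤ M * (‖ι‖ * ‖v‖) * (‖ι‖ * ‖v‖) * (‖ι‖ * ‖z‖) := by positivity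
    nlinarith
  refine (h.norm_le_of_forall (by positivity) key).trans_eq (by ring)

/-- On bounded sets of velocities, the Christoffel operator is Lipschitz with respect to the weaker
norm of `Y` in position and velocity. -/
theorem exists_christoffel_lip [CompleteSpace V] (h : MetricBounds ι g c M) (R : ℝ) :
    ∃ C, 0 ≤ C ∧ ∀ y y' v v' : V, ‖v‖ ≤ R → ‖v'‖ ≤ R →
      ‖christoffel g y v v - christoffel g y' v' v'‖ ≤ C * (‖ι y - ι y'‖ + ‖ι v - ι v'‖) := by
  have hM := h.M_nonneg
  have hc := h.c_pos
  set S := |R| with hS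
  have hS0 : 0 ≤ S := abs_nonneg R
  set C := 2 * M * (‖ι‖ * S) ^ 2 * ‖ι‖ + 4 * M * (‖ι‖ * S) * ‖ι‖ +
    M * (3 * M * ‖ι‖ ^ 3 / c * S ^ 2) with hC
  have hC0 : 0 ≤ C := by positivity
  refine ⟨C / c, by positivity, fun y y' v v' hv hv' => ?_⟩
  replace hv : ‖v‖ ≤ S := hv.trans (le_abs_self R)
  replace hv' : ‖v'‖ ≤ S := hv'.trans (le_abs_self R)
  set p := ‖ι y - ι y'‖ with hp
  set q := ‖ι v - ι v'‖ with hq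
  have hp0 : 0 ≤ p := norm_nonneg _
  have hq0 : 0 ≤ q := norm_nonneg _
  have hιv : ‖ι v‖ ≤ ‖ι‖ * S := (ι.le_opNorm v).trans (by gcongr)
  have hιv' : ‖ι v'‖ ≤ ‖ι‖ * S := (ι.le_opNorm v').trans (by gcongr)
  -- the derivative of the metric, evaluated at two copies of the velocity, is locally Lipschitz
  have hT : ∀ z, |fderiv ℝ g y v v z - fderiv ℝ g y' v' v' z| ≤
      (M * (‖ι‖ * S) ^ 2 * p + 2 * M * (‖ι‖ * S) * q) * (‖ι‖ * ‖z‖) := by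
    intro z
    have e : fderiv ℝ g y v v z - fderiv ℝ g y' v' v' z =
        (fderiv ℝ g y v v z - fderiv ℝ g y' v v z) + fderiv ℝ g y' (v - v') v z +
          fderiv ℝ g y' v' (v - v') z := by
      simp only [map_sub, sub_apply]
      ring
    have b1 : M * p * ‖ι v‖ * ‖ι v‖ * ‖ι z‖ ≤ M * p * (‖ι‖ * S) * (‖ι‖ * S) * (‖ι‖ * ‖z‖) := by
      gcongr
      exact ι.le_opNorm z
    have b2 : M * ‖ι (v - v')‖ * ‖ι v‖ * ‖ι z‖ ≤ M * q * (‖ι‖ * S) * (‖ι‖ * ‖z‖) := by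
      rw [map_sub]
      gcongr
      exact ι.le_opNorm z
    have b3 : M * ‖ι v'‖ * ‖ι (v - v')‖ * ‖ι z‖ ≤ M * (‖ι‖ * S) * q * (‖ι‖ * ‖z‖) := by
      rw [map_sub]
      gcongr
      exact ι.le_opNorm z
    rw [e]
    refine (abs_add_three _ _ _).trans ?_
    have a1 := (h.fderiv_lip y y' v v z).trans b1
    have a2 := (h.fderiv_bound y' (v - v') v z).trans b2
    have a3 := (h.fderiv_bound y' v' (v - v') z).trans b3
    refine (add_le_add (add_le_add a1 a2) a3).trans_eq (by ring)
  have hT' : ∀ z, |fderiv ℝ g y z v v - fderiv ℝ g y' z v' v'| ≤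
      (M * (‖ι‖ * S) ^ 2 * p + 2 * M * (‖ι‖ * S) * q) * (‖ι‖ * ‖z‖) := by
    intro z
    have e : fderiv ℝ g y z v v - fderiv ℝ g y' z v' v' =
        (fderiv ℝ g y z v v - fderiv ℝ g y' z v v) + fderiv ℝ g y' z (v - v') v +
          fderiv ℝ g y' z v' (v - v') := by
      simp only [map_sub, sub_apply]
      ring
    have b1 : M * p * ‖ι z‖ * ‖ι v‖ * ‖ι v‖ ≤ M * p * (‖ι‖ * ‖z‖) * (‖ι‖ * S) * (‖ι‖ * S) := by
      gcongr
      exact ι.le_opNorm z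
    have b2 : M * ‖ι z‖ * ‖ι (v - v')‖ * ‖ι v‖ ≤ M * (‖ι‖ * ‖z‖) * q * (‖ι‖ * S) := by
      rw [map_sub]
      gcongr
      exact ι.le_opNorm z
    have b3 : M * ‖ι z‖ * ‖ι v'‖ * ‖ι (v - v')‖ ≤ M * (‖ι‖ * ‖z‖) * (‖ι‖ * S) * q := by
      rw [map_sub]
      gcongr
      exact ι.le_opNorm z
    rw [e]
    refine (abs_add_three _ _ _).trans ?_
    have a1 := (h.fderiv_lip y y' z v v).trans b1
    have a2 := (h.fderiv_bound y' z (v - v') v).trans b2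
    have a3 := (h.fderiv_bound y' z v' (v - v')).trans b3
    refine (add_le_add (add_le_add a1 a2) a3).trans_eq (by ring)
  have key : ∀ z, g y (christoffel g y v v - christoffel g y' v' v') z ≤
      (C * (p + q)) * ‖z‖ := by
    intro z
    have h1 := h.two_mul_apply_christoffel y v z
    have h2 := h.two_mul_apply_christoffel y' v' z
    have h3 := (abs_le.mp (h.lip y y' (christoffel g y' v' v') z)).1
    have h4 : M * ‖ι y - ι y'‖ * ‖christoffel g y' v' v'‖ * ‖z‖ ≤
        M * p * (3 * M * ‖ι‖ ^ 3 / c * S ^ 2) * ‖z‖ := by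
      gcongr
      exact (h.norm_christoffel_le y' v').trans (by gcongr)
    have h5 := (abs_le.mp (hT z)).2
    have h6 := (abs_le.mp (hT' z)).1
    have h7 : 0 ≤ 4 * M * (‖ι‖ * S) * ‖ι‖ * p * ‖z‖ := by positivity
    have h8 : 0 ≤ 2 * M * (‖ι‖ * S) ^ 2 * ‖ι‖ * q * ‖z‖ := by positivity
    have h9 : 0 ≤ M * (3 * M * ‖ι‖ ^ 3 / c * S ^ 2) * q * ‖z‖ := by positivity
    have h10 : 0 ≤ M * (‖ι‖ * S) ^ 2 * p * ‖ι‖ * ‖z‖ := by positivity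
    have h11 : 0 ≤ M * (‖ι‖ * S) * q * ‖ι‖ * ‖z‖ := by positivity
    rw [map_sub, sub_apply, hC]
    linarith
  exact (h.norm_le_of_forall (by positivity) key).trans_eq (by ring)

theorem continuous (h : MetricBounds ι g c M) : Continuous g := h.differentiable.continuous

theorem continuous_christoffel [CompleteSpace V] (h : MetricBounds ι g c M) :
    Continuous fun x : V × V => christoffel g x.1 x.2 x.2 := by
  rw [continuous_iff_continuousAt]
  intro x
  obtain ⟨C, hC, hlip⟩ := h.exists_christoffel_lip (‖x.2‖ + 1)
  rw [ContinuousAt, tendsto_iff_norm_sub_tendsto_zero]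
  have hev : ∀ᶠ x' : V × V in 𝓝 x, ‖x'.2‖ ≤ ‖x.2‖ + 1 := by
    have : Continuous fun x' : V × V => ‖x'.2‖ := by fun_prop
    exact (this.continuousAt.eventually_lt continuousAt_const (lt_add_one _)).mono
      fun _ => le_of_lt
  have hlim : Tendsto (fun x' : V × V => C * (‖ι x'.1 - ι x.1‖ + ‖ι x'.2 - ι x.2‖)) (𝓝 x)
      (𝓝 0) := by
    have : Continuous fun x' : V × V => C * (‖ι x'.1 - ι x.1‖ + ‖ι x'.2 - ι x.2‖) := by fun_prop
    simpa using this.tendsto x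
  refine squeeze_zero' (Eventually.of_forall fun _ => norm_nonneg _) ?_ hlim
  filter_upwards [hev] with x' hx'
  exact hlip _ _ _ _ hx' (by linarith)

end MetricBounds

end Metric

/-! ### Weak convergence -/

section Weak

variable {H : Type*} [NormedAddCommGroup H] [InnerProductSpace ℝ H]

/-- Weak convergence of a sequence in a Hilbert space. -/
def WeakTendsto (x : ℕ → H) (x₀ : H) : Prop :=
  ∀ z : H, Tendsto (fun k => inner ℝ z (x k)) atTop (𝓝 (inner ℝ z x₀))

theorem WeakTendsto.comp {x : ℕ → H} {x₀ : H} (h : WeakTendsto x x₀) {φ : ℕ → ℕ}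
    (hφ : StrictMono φ) : WeakTendsto (x ∘ φ) x₀ :=
  fun z => (h z).comp hφ.tendsto_atTop

theorem WeakTendsto.unique {x : ℕ → H} {x₀ x₁ : H} (h : WeakTendsto x x₀) (h' : WeakTendsto x x₁) :
    x₀ = x₁ :=
  ext_inner_left ℝ fun z => tendsto_nhds_unique (h z) (h' z)

theorem weakTendsto_const (x : H) : WeakTendsto (fun _ => x) x := fun _ => tendsto_const_nhds

theorem WeakTendsto.apply_dual [CompleteSpace H] {x : ℕ → H} {x₀ : H} (h : WeakTendsto x x₀)
    (f : H →L[ℝ] ℝ) : Tendsto (fun k => f (x k)) atTop (𝓝 (f x₀)) := by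
  simpa using h ((InnerProductSpace.toDual ℝ H).symm f)

theorem exists_weakTendsto_subseq [CompleteSpace H] [TopologicalSpace.SeparableSpace H]
    {x : ℕ → H} {R : ℝ} (hx : ∀ k, ‖x k‖ ≤ R) :
    ∃ (x₀ : H) (φ : ℕ → ℕ), StrictMono φ ∧ WeakTendsto (x ∘ φ) x₀ := by
  obtain ⟨f, -, φ, hφ, hlim⟩ := WeakDual.isSeqCompact_closedBall ℝ H 0 R
    (x := fun k => StrongDual.toWeakDual (InnerProductSpace.toDual ℝ H (x k))) (fun k => by
      rw [mem_preimage, mem_closedBall_zero_iff]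
      exact ((InnerProductSpace.toDual ℝ H).norm_map (x k)).trans_le (hx k))
  refine ⟨(InnerProductSpace.toDual ℝ H).symm (WeakDual.toStrongDual f), φ, hφ, fun z => ?_⟩
  have h1 := ((WeakDual.eval_continuous z).tendsto f).comp hlim
  rw [real_inner_comm, InnerProductSpace.toDual_symm_apply]
  refine h1.congr fun k => ?_
  exact real_inner_comm _ _

/-- Compact operators turn bounded weakly convergent sequences into convergent ones. -/
theorem WeakTendsto.map_compact [CompleteSpace H] {Y : Type*} [NormedAddCommGroup Y]
    [NormedSpace ℝ Y] {ι : H →L[ℝ] Y} (hι : IsCompactOperator ι) {x : ℕ → H} {x₀ : H}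
    (h : WeakTendsto x x₀) {R : ℝ} (hx : ∀ k, ‖x k‖ ≤ R) :
    Tendsto (fun k => ι (x k)) atTop (𝓝 (ι x₀)) := by
  have hK : IsCompact (closure (ι '' Metric.closedBall 0 R)) :=
    IsCompactOperator.isCompact_closure_image_closedBall (f := (ι : H →ₗ[ℝ] Y)) hι R
  refine hK.tendsto_nhds_of_unique_mapClusterPt (Eventually.of_forall fun k =>
    subset_closure (mem_image_of_mem ι (mem_closedBall_zero_iff.mpr (hx k)))) fun y _ hy => ?_
  obtain ⟨φ, hφ, hlim⟩ := hy.tendsto_subseq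
  refine (SeparatingDual.eq_iff_forall_dual_eq (R := ℝ)).mpr fun f => ?_
  exact tendsto_nhds_unique ((f.continuous.tendsto y).comp hlim)
    ((h.apply_dual (f.comp ι)).comp hφ.tendsto_atTop)

end Weak

section Curve

variable {V : Type*} [NormedAddCommGroup V] [InnerProductSpace ℝ V]

theorem norm_pos_le (a b : V) {w : ℝ → V} (hw : Integrable w unitMeasure) {t : ℝ}
    (ht : t ∈ Icc (0 : ℝ) 1) :
    ‖pos a b w t‖ ≤ ‖a‖ + (‖b‖ + ∫ x, ‖w x‖ ∂unitMeasure) := by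
  refine (norm_add_le _ _).trans (add_le_add_right ?_ _)
  have hR : 0 ≤ ‖b‖ + ∫ x, ‖w x‖ ∂unitMeasure := (norm_nonneg _).trans (norm_vel_le b hw 0)
  refine (intervalIntegral.norm_integral_le_of_norm_le_const
    fun s _ => norm_vel_le b hw s).trans ?_
  rw [sub_zero, abs_of_nonneg ht.1]
  exact mul_le_of_le_one_right hR ht.2

theorem integral_mul_le_sqrt_mul_sqrt {f h : ℝ → ℝ} (hf0 : ∀ t, 0 ≤ f t) (hh0 : ∀ t, 0 ≤ h t)
    (hf : MemLp f 2 unitMeasure) (hh : MemLp h 2 unitMeasure) :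
    ∫ t, f t * h t ∂unitMeasure ≤
      √(∫ t, f t ^ 2 ∂unitMeasure) * √(∫ t, h t ^ 2 ∂unitMeasure) := by
  have := integral_mul_le_Lp_mul_Lq_of_nonneg (μ := unitMeasure) (p := 2) (q := 2)
    Real.HolderConjugate.two_two (Eventually.of_forall hf0) (Eventually.of_forall hh0)
    (by simpa using hf) (by simpa using hh)
  simpa [Real.sqrt_eq_rpow] using this

omit [InnerProductSpace ℝ V] in
theorem MemL2.integral_norm_le {w : ℝ → V} (hw : MemL2 w) :
    ∫ t, ‖w t‖ ∂unitMeasure ≤ √(∫ t, ‖w t‖ ^ 2 ∂unitMeasure) := by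
  have h := integral_mul_le_sqrt_mul_sqrt (f := fun _ => 1) (h := fun t => ‖w t‖)
    (fun _ => zero_le_one) (fun _ => norm_nonneg _) (memLp_const 1) (MemLp.norm hw)
  simpa using h

omit [InnerProductSpace ℝ V] in
theorem MemL2.integrable_norm_sq {w : ℝ → V} (hw : MemL2 w) :
    Integrable (fun t => ‖w t‖ ^ 2) unitMeasure :=
  (memLp_two_iff_integrable_sq_norm hw.1).mp hw

theorem MemL2.integrable_inner {f w : ℝ → V} (hf : MemL2 f) (hw : MemL2 w) :
    Integrable (fun t => inner ℝ (f t) (w t)) unitMeasure :=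
  Integrable.mono' (MemLp.integrable_mul (MemLp.norm hf) (MemLp.norm hw)) (hf.1.inner hw.1)
    (Eventually.of_forall fun _ => norm_inner_le_norm _ _)

theorem integral_norm_sq_Lp (W : Lp V 2 unitMeasure) :
    ∫ t, ‖W t‖ ^ 2 ∂unitMeasure = ‖W‖ ^ 2 := by
  rw [← real_inner_self_eq_norm_sq, L2.inner_def]
  simp

variable [CompleteSpace V]

theorem MemW22.exists_eqOn_pos_Lp {y : ℝ → V} (hy : MemW22 y) :
    ∃ (a b : V) (W : Lp V 2 unitMeasure), EqOn y (pos a b W) (Icc 0 1) := by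
  obtain ⟨a, b, w, hw, h⟩ := hy.exists_eqOn_pos
  refine ⟨a, b, MemLp.toLp w hw, ?_⟩
  rwa [pos_congr (MemLp.coeFn_toLp hw)]

omit [InnerProductSpace ℝ V] [CompleteSpace V] in
theorem memL2_Lp (W : Lp V 2 unitMeasure) : MemL2 W := Lp.memLp W

variable {b : ℕ → V} {b₀ : V} {W : ℕ → Lp V 2 unitMeasure} {W₀ : Lp V 2 unitMeasure}

theorem WeakTendsto.vel (hb : WeakTendsto b b₀) (hW : WeakTendsto W W₀) {t : ℝ} (ht : 0 ≤ t) :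
    WeakTendsto (fun k => vel (b k) (W k) t) (vel b₀ W₀ t) := by
  intro z
  have h : ∀ U : Lp V 2 unitMeasure, inner ℝ z (∫ s in (0 : ℝ)..t, U s ∂unitMeasure) =
      inner ℝ (indicatorConstLp 2 (measurableSet_Ioc (a := (0 : ℝ)) (b := t))
        (measure_ne_top unitMeasure _) z) U := by
    intro U
    rw [L2.inner_indicatorConstLp_eq_inner_setIntegral, intervalIntegral.integral_of_le ht]
  simp only [RiemannianSpline.vel, inner_add_right, h]
  exact (hb z).add (hW _)

omit [CompleteSpace V] in
theorem norm_vel_Lp_le {R : ℝ} (hb : ∀ k, ‖b k‖ ≤ R) (hW : ∀ k, ‖W k‖ ≤ R) (k : ℕ) (t : ℝ) :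
    ‖RiemannianSpline.vel (b k) (W k) t‖ ≤ 2 * R := by
  have h1 := norm_vel_le (b k) (memL2_Lp (W k)).integrable t
  have h2 := (memL2_Lp (W k)).integral_norm_le
  rw [integral_norm_sq_Lp, Real.sqrt_sq (norm_nonneg _)] at h2
  linarith [hb k, hW k]

omit [CompleteSpace V] in
theorem norm_pos_Lp_le {a : ℕ → V} {R : ℝ} (ha : ∀ k, ‖a k‖ ≤ R) (hb : ∀ k, ‖b k‖ ≤ R)
    (hW : ∀ k, ‖W k‖ ≤ R) (k : ℕ) {t : ℝ} (ht : t ∈ Icc (0 : ℝ) 1) :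
    ‖pos (a k) (b k) (W k) t‖ ≤ 3 * R := by
  have h1 := norm_pos_le (a k) (b k) (memL2_Lp (W k)).integrable ht
  have h2 := (memL2_Lp (W k)).integral_norm_le
  rw [integral_norm_sq_Lp, Real.sqrt_sq (norm_nonneg _)] at h2
  linarith [ha k, hb k, hW k]

theorem WeakTendsto.pos {a : ℕ → V} {a₀ : V} (ha : WeakTendsto a a₀) (hb : WeakTendsto b b₀)
    (hW : WeakTendsto W W₀) {R : ℝ} (hbR : ∀ k, ‖b k‖ ≤ R) (hWR : ∀ k, ‖W k‖ ≤ R) {t : ℝ}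
    (ht : 0 ≤ t) : WeakTendsto (fun k => pos (a k) (b k) (W k) t) (pos a₀ b₀ W₀ t) := by
  intro z
  have hc : ∀ (b : V) (U : Lp V 2 unitMeasure), Continuous (RiemannianSpline.vel b U) :=
    fun b U => continuous_vel (memL2_Lp U).integrable
  have h : ∀ (b : V) (U : Lp V 2 unitMeasure),
      inner ℝ z (∫ s in (0 : ℝ)..t, RiemannianSpline.vel b U s) =
        ∫ s in (0 : ℝ)..t, inner ℝ z (RiemannianSpline.vel b U s) := by
    intro b U
    exact ((innerSL ℝ z).intervalIntegral_comp_comm ((hc b U).intervalIntegrable 0 t)).symm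
  simp only [RiemannianSpline.pos, inner_add_right, h]
  refine (ha z).add (intervalIntegral.tendsto_integral_filter_of_dominated_convergence
    (fun _ => ‖z‖ * (2 * R)) (Eventually.of_forall fun k => ?_) (Eventually.of_forall fun k =>
    Eventually.of_forall fun s _ => ?_) intervalIntegrable_const
    (Eventually.of_forall fun s hs => ?_))
  · exact (continuous_const.inner (hc _ _)).aestronglyMeasurable
  · exact (norm_inner_le_norm _ _).trans (by gcongr; exact norm_vel_Lp_le hbR hWR k s)
  · rw [uIoc_of_le ht] at hs
    exact WeakTendsto.vel hb hW hs.1.le z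

end Curve

/-! ### The energies as functionals of the initial data and the acceleration -/

section Energy

variable {V Y : Type*} [NormedAddCommGroup V] [InnerProductSpace ℝ V] [CompleteSpace V]
  [NormedAddCommGroup Y] [NormedSpace ℝ Y] {ι : V →L[ℝ] Y} {g : V → V →L[ℝ] V →L[ℝ] ℝ} {c M : ℝ}

/-- The integral of the squared length of the vector field `u` along `y`. -/
def fieldEnergy (g : V → V →L[ℝ] V →L[ℝ] ℝ) (y u : ℝ → V) : ℝ :=
  ∫ t, g (y t) (u t) (u t) ∂unitMeasure

/-- The covariant acceleration of the curve `pos a b w`. -/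
def cov (g : V → V →L[ℝ] V →L[ℝ] ℝ) (a b : V) (w : ℝ → V) (t : ℝ) : V :=
  w t + christoffel g (pos a b w t) (vel b w t) (vel b w t)

omit [CompleteSpace V] in
theorem MetricBounds.aestronglyMeasurable (h : MetricBounds ι g c M) {y u v : ℝ → V}
    (hy : Continuous y) (hu : AEStronglyMeasurable u unitMeasure)
    (hv : AEStronglyMeasurable v unitMeasure) :
    AEStronglyMeasurable (fun t => g (y t) (u t) (v t)) unitMeasure := by
  have hc : Continuous fun x : V × V × V => g x.1 x.2.1 x.2.2 :=
    ((h.continuous.comp continuous_fst).clm_apply continuous_snd.fst).clm_apply continuous_snd.snd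
  exact hc.comp_aestronglyMeasurable (hy.aestronglyMeasurable.prodMk (hu.prodMk hv))

omit [CompleteSpace V] in
theorem MetricBounds.integrable (h : MetricBounds ι g c M) {y u v : ℝ → V}
    (hy : Continuous y) (hu : MemL2 u) (hv : MemL2 v) :
    Integrable (fun t => g (y t) (u t) (v t)) unitMeasure := by
  refine Integrable.mono' (((MemLp.norm hu).integrable_mul (MemLp.norm hv)).const_mul M)
    (h.aestronglyMeasurable hy hu.1 hv.1) (Eventually.of_forall fun t => ?_)
  simpa [mul_assoc] using h.bound (y t) (u t) (v t)

omit [CompleteSpace V] in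
theorem MetricBounds.fieldEnergy_nonneg (h : MetricBounds ι g c M) (y u : ℝ → V) :
    0 ≤ fieldEnergy g y u :=
  integral_nonneg fun t => h.nonneg (y t) (u t)

omit [CompleteSpace V] in
theorem MetricBounds.integral_norm_sq_le (h : MetricBounds ι g c M) {y u : ℝ → V}
    (hy : Continuous y) (hu : MemL2 u) :
    ∫ t, ‖u t‖ ^ 2 ∂unitMeasure ≤ fieldEnergy g y u / c := by
  rw [le_div_iff₀ h.c_pos, ← integral_mul_const]
  refine integral_mono (hu.integrable_norm_sq.mul_const c) (h.integrable hy hu hu) fun t => ?_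
  simpa [mul_comm] using h.coercive (y t) (u t)

theorem MetricBounds.continuous_christoffel_curve (h : MetricBounds ι g c M) (a b : V) {w : ℝ → V}
    (hw : Integrable w unitMeasure) :
    Continuous fun t => christoffel g (pos a b w t) (vel b w t) (vel b w t) :=
  h.continuous_christoffel.comp ((continuous_pos hw).prodMk (continuous_vel hw))

theorem MetricBounds.memL2_cov (h : MetricBounds ι g c M) (a b : V) {w : ℝ → V} (hw : MemL2 w) :
    MemL2 (cov g a b w) :=
  MemLp.add hw (memL2_of_continuous (h.continuous_christoffel_curve a b hw.integrable))

/-- The regularized spline energy as a functional of the initial data and the acceleration; the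
choice of the weak derivative in `acceleration` affects it on a null set only. -/
theorem regSplineEnergy_eq (σ : ℝ) {y : ℝ → V} {a b : V} {w : ℝ → V} (hw : MemL2 w)
    (h : EqOn y (pos a b w) (Icc 0 1)) :
    regSplineEnergy g σ y = fieldEnergy g (pos a b w) (cov g a b w) +
      σ * fieldEnergy g (pos a b w) (vel b w) := by
  rw [regSplineEnergy, splineEnergy, pathEnergy, fieldEnergy, fieldEnergy]
  have hv := velocity_eqOn_vel hw.integrable h
  congr 1
  · refine integral_congr_ae ?_
    filter_upwards [acceleration_ae_eq hw h, ae_unitMeasure_mem] with t h1 h2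
    have ht := Ioo_subset_Icc_self h2
    simp only [covAcceleration, cov, h1, h ht, hv ht]
  · congr 1
    refine integral_congr_ae ?_
    filter_upwards [ae_unitMeasure_mem] with t h2
    have ht := Ioo_subset_Icc_self h2
    simp only [h ht, hv ht]

/-- The field `f` dual to `u` along `y`, that is, `g (y t) (u t) = ⟪f t, ·⟫`. -/
theorem MetricBounds.exists_dual_field (h : MetricBounds ι g c M) {y u : ℝ → V}
    (hy : Continuous y) (hu : MemL2 u) :
    ∃ f : ℝ → V, MemL2 f ∧ ∀ t v, inner ℝ (f t) v = g (y t) (u t) v := by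
  refine ⟨fun t => (InnerProductSpace.toDual ℝ V).symm (g (y t) (u t)), ?_,
    fun t v => InnerProductSpace.toDual_symm_apply⟩
  refine MemLp.of_le_mul (c := M) (MemLp.norm hu) ?_ (Eventually.of_forall fun t => ?_)
  · have hc : Continuous fun x : V × V => (InnerProductSpace.toDual ℝ V).symm (g x.1 x.2) :=
      (InnerProductSpace.toDual ℝ V).symm.continuous.comp
        ((h.continuous.comp continuous_fst).clm_apply continuous_snd)
    exact hc.comp_aestronglyMeasurable (hy.aestronglyMeasurable.prodMk hu.1)
  · rw [LinearIsometryEquiv.norm_map, norm_norm]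
    exact ContinuousLinearMap.opNorm_le_bound _ (mul_nonneg h.M_nonneg (norm_nonneg _))
      fun w => h.bound _ _ _

/-- Lower semicontinuity of the field energy: if the base curves converge in `Y` and the fields
converge weakly in `L²`, then the energies are bounded below by a sequence that converges to the
energy of the limit. -/
theorem MetricBounds.fieldEnergy_lowerBound (h : MetricBounds ι g c M) {y : ℕ → ℝ → V}
    {y₀ : ℝ → V} {u : ℕ → ℝ → V} {u₀ : ℝ → V} (hy : ∀ k, Continuous (y k)) (hy₀ : Continuous y₀)
    (hu : ∀ k, MemL2 (u k)) (hu₀ : MemL2 u₀) {R : ℝ}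
    (hyR : ∀ k, ∀ t ∈ Icc (0 : ℝ) 1, ‖ι (y k t) - ι (y₀ t)‖ ≤ R)
    (huR : ∀ k, ∫ t, ‖u k t‖ ^ 2 ∂unitMeasure ≤ R)
    (hylim : ∀ t ∈ Icc (0 : ℝ) 1, Tendsto (fun k => ι (y k t)) atTop (𝓝 (ι (y₀ t))))
    (hulim : ∀ f : ℝ → V, MemL2 f → Tendsto (fun k => ∫ t, inner ℝ (f t) (u k t) ∂unitMeasure) atTop
      (𝓝 (∫ t, inner ℝ (f t) (u₀ t) ∂unitMeasure))) :
    ∃ A : ℕ → ℝ, (∀ k, A k ≤ fieldEnergy g (y k) (u k)) ∧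
      Tendsto A atTop (𝓝 (fieldEnergy g y₀ u₀)) := by
  have hM := h.M_nonneg
  set d : ℕ → ℝ → ℝ := fun k t => ‖ι (y k t) - ι (y₀ t)‖ with hd
  have hdc : ∀ k, Continuous (d k) := fun k =>
    ((ι.continuous.comp (hy k)).sub (ι.continuous.comp hy₀)).norm
  have hd0 : ∀ k t, 0 ≤ d k t := fun k t => norm_nonneg _
  have hdR : ∀ k, ∀ᵐ t ∂unitMeasure, ‖d k t‖ ≤ R := fun k => by
    filter_upwards [ae_unitMeasure_mem] with t ht
    rw [Real.norm_of_nonneg (hd0 k t)]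
    exact hyR k t (Ioo_subset_Icc_self ht)
  have hdlim : ∀ᵐ t ∂unitMeasure, Tendsto (fun k => d k t) atTop (𝓝 0) := by
    filter_upwards [ae_unitMeasure_mem] with t ht
    exact tendsto_iff_norm_sub_tendsto_zero.mp (hylim t (Ioo_subset_Icc_self ht))
  have hdu2 : ∀ k, MemLp (fun t => d k t * ‖u₀ t‖) 2 unitMeasure := fun k =>
    MemLp.of_le_mul (MemLp.norm hu₀) ((hdc k).aestronglyMeasurable.mul hu₀.1.norm) (by
      filter_upwards [hdR k] with t ht
      rw [norm_mul]
      exact mul_le_mul_of_nonneg_right ht (norm_nonneg _))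
  have hu₀n := hu₀.integrable_norm_sq
  have hdu1 : ∀ k, Integrable (fun t => d k t * ‖u₀ t‖ ^ 2) unitMeasure := fun k =>
    hu₀n.bdd_mul (hdc k).aestronglyMeasurable (hdR k)
  obtain ⟨f, hf2, hfi⟩ := h.exists_dual_field hy₀ hu₀
  refine ⟨fun k => 2 * (∫ t, inner ℝ (f t) (u k t) ∂unitMeasure)
    - 2 * M * (√(∫ t, (d k t * ‖u₀ t‖) ^ 2 ∂unitMeasure) * √R)
    - fieldEnergy g y₀ u₀ - M * ∫ t, d k t * ‖u₀ t‖ ^ 2 ∂unitMeasure, fun k => ?_, ?_⟩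
  · have hi1 := h.integrable hy₀ hu₀ (hu k)
    have hi2 := h.integrable hy₀ hu₀ hu₀
    have hi3 : Integrable (fun t => d k t * ‖u₀ t‖ * ‖u k t‖) unitMeasure :=
      (hdu2 k).integrable_mul (MemLp.norm (hu k))
    have hcs := integral_mul_le_sqrt_mul_sqrt (fun t => mul_nonneg (hd0 k t) (norm_nonneg (u₀ t)))
      (fun t => norm_nonneg (u k t)) (hdu2 k) (MemLp.norm (hu k))
    have hcs' := hcs.trans (mul_le_mul_of_nonneg_left (Real.sqrt_le_sqrt (huR k))
      (Real.sqrt_nonneg _))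
    -- convexity of `g (y k t)` at `u₀ t`, with the base point moved to `y₀ t` in all terms but one
    have hpt : ∀ t, 2 * g (y₀ t) (u₀ t) (u k t) - 2 * M * (d k t * ‖u₀ t‖ * ‖u k t‖)
        - g (y₀ t) (u₀ t) (u₀ t) - M * (d k t * ‖u₀ t‖ ^ 2) ≤ g (y k t) (u k t) (u k t) := by
      intro t
      have e1 := h.nonneg (y k t) (u k t - u₀ t)
      have e2 := (abs_le.mp (h.lip (y k t) (y₀ t) (u₀ t) (u k t))).1
      have e3 := (abs_le.mp (h.lip (y k t) (y₀ t) (u₀ t) (u₀ t))).2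
      have e4 := h.symm (y k t) (u₀ t) (u k t)
      simp only [map_sub, sub_apply] at e1
      simp only [hd]
      nlinarith
    have hi4 : Integrable (fun t => 2 * g (y₀ t) (u₀ t) (u k t) -
        2 * M * (d k t * ‖u₀ t‖ * ‖u k t‖)) unitMeasure :=
      (hi1.const_mul 2).sub (hi3.const_mul (2 * M))
    have hi5 : Integrable (fun t => 2 * g (y₀ t) (u₀ t) (u k t) -
        2 * M * (d k t * ‖u₀ t‖ * ‖u k t‖) - g (y₀ t) (u₀ t) (u₀ t)) unitMeasure := hi4.sub hi2
    have hint := integral_mono (hi5.sub ((hdu1 k).const_mul M))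
      (h.integrable (hy k) (hu k) (hu k)) hpt
    simp only [Pi.sub_apply] at hint
    rw [integral_sub hi5 ((hdu1 k).const_mul M), integral_sub hi4 hi2,
      integral_sub (hi1.const_mul 2) (hi3.const_mul (2 * M)), integral_const_mul,
      integral_const_mul, integral_const_mul] at hint
    simp only [hfi, fieldEnergy]
    nlinarith
  · have l1 : Tendsto (fun k => ∫ t, (d k t * ‖u₀ t‖) ^ 2 ∂unitMeasure) atTop (𝓝 0) := by
      have := tendsto_integral_of_dominated_convergence (μ := unitMeasure)
        (F := fun k t => (d k t * ‖u₀ t‖) ^ 2) (f := fun _ => 0) (fun t => R ^ 2 * ‖u₀ t‖ ^ 2)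
        (fun k => (hdu2 k).1.pow 2) (hu₀n.const_mul _) (fun k => by
          filter_upwards [hdR k] with t ht
          rw [Real.norm_of_nonneg (sq_nonneg _), mul_pow]
          rw [Real.norm_of_nonneg (hd0 k t)] at ht
          exact mul_le_mul_of_nonneg_right (pow_le_pow_left₀ (hd0 k t) ht 2)
            (sq_nonneg _)) (by
          filter_upwards [hdlim] with t ht
          simpa using (ht.mul_const ‖u₀ t‖).pow 2)
      simpa using this
    have l2 : Tendsto (fun k => ∫ t, d k t * ‖u₀ t‖ ^ 2 ∂unitMeasure) atTop (𝓝 0) := by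
      have := tendsto_integral_of_dominated_convergence (μ := unitMeasure)
        (F := fun k t => d k t * ‖u₀ t‖ ^ 2) (f := fun _ => 0) (fun t => R * ‖u₀ t‖ ^ 2)
        (fun k => (hdu1 k).1) (hu₀n.const_mul _) (fun k => by
          filter_upwards [hdR k] with t ht
          rw [Real.norm_of_nonneg (mul_nonneg (hd0 k t) (sq_nonneg _))]
          rw [Real.norm_of_nonneg (hd0 k t)] at ht
          exact mul_le_mul_of_nonneg_right ht (sq_nonneg _)) (by
          filter_upwards [hdlim] with t ht
          simpa using ht.mul_const (‖u₀ t‖ ^ 2))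
      simpa using this
    have l3 := hulim f hf2
    have e : ∫ t, inner ℝ (f t) (u₀ t) ∂unitMeasure = fieldEnergy g y₀ u₀ := by
      simp only [hfi, fieldEnergy]
    rw [e] at l3
    have l4 := ((((l3.const_mul 2).sub (((l1.sqrt).mul_const √R).const_mul (2 * M))).sub_const
      (fieldEnergy g y₀ u₀)).sub (l2.const_mul M))
    simpa [two_mul] using l4

/-- Lower semicontinuity of the regularized spline energy along weakly convergent data. By
compactness of `ι` position and velocity converge pointwise in `Y`, hence the Christoffel terms
converge in `V`; so the velocities and the covariant accelerations converge weakly in `L²`, and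
`MetricBounds.fieldEnergy_lowerBound` applies to both. -/
theorem MetricBounds.energy_lowerBound (h : MetricBounds ι g c M) (hι : IsCompactOperator ι)
    {σ : ℝ} (hσ : 0 ≤ σ)
    {a b : ℕ → V} {a₀ b₀ : V} {W : ℕ → Lp V 2 unitMeasure} {W₀ : Lp V 2 unitMeasure}
    (ha : WeakTendsto a a₀) (hb : WeakTendsto b b₀) (hW : WeakTendsto W W₀) {R : ℝ}
    (haR : ∀ k, ‖a k‖ ≤ R) (hbR : ∀ k, ‖b k‖ ≤ R) (hWR : ∀ k, ‖W k‖ ≤ R) :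
    ∃ A : ℕ → ℝ, (∀ k, A k ≤ fieldEnergy g (pos (a k) (b k) (W k)) (cov g (a k) (b k) (W k)) +
      σ * fieldEnergy g (pos (a k) (b k) (W k)) (vel (b k) (W k))) ∧
      Tendsto A atTop (𝓝 (fieldEnergy g (pos a₀ b₀ W₀) (cov g a₀ b₀ W₀) +
        σ * fieldEnergy g (pos a₀ b₀ W₀) (vel b₀ W₀))) := by
  have hR0 : 0 ≤ R := (norm_nonneg _).trans (haR 0)
  have hi : ∀ U : Lp V 2 unitMeasure, Integrable U unitMeasure := fun U => (memL2_Lp U).integrable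
  have hvc : ∀ k, Continuous (vel (b k) (W k)) := fun k => continuous_vel (hi _)
  have hv2 : ∀ k, MemL2 (vel (b k) (W k)) := fun k => memL2_of_continuous (hvc k)
  have hvR : ∀ k t, ‖vel (b k) (W k) t‖ ≤ 2 * R := norm_vel_Lp_le hbR hWR
  have hvlim : ∀ t ∈ Icc (0 : ℝ) 1, WeakTendsto (fun k => vel (b k) (W k) t) (vel b₀ W₀ t) :=
    fun t ht => WeakTendsto.vel hb hW ht.1
  have hplim : ∀ t ∈ Icc (0 : ℝ) 1,
      Tendsto (fun k => ι (pos (a k) (b k) (W k) t)) atTop (𝓝 (ι (pos a₀ b₀ W₀ t))) :=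
    fun t ht => (WeakTendsto.pos ha hb hW hbR hWR ht.1).map_compact hι
      fun k => norm_pos_Lp_le haR hbR hWR k ht
  -- position, velocity and covariant acceleration are bounded uniformly in the sequence
  set S := ‖a₀‖ + (‖b₀‖ + ∫ x, ‖W₀ x‖ ∂unitMeasure) with hS
  have hpR : ∀ k, ∀ t ∈ Icc (0 : ℝ) 1,
      ‖ι (pos (a k) (b k) (W k) t) - ι (pos a₀ b₀ W₀ t)‖ ≤ ‖ι‖ * (3 * R + S) := by
    intro k t ht
    rw [← map_sub]
    refine (ι.le_opNorm _).trans ?_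
    gcongr
    exact (norm_sub_le _ _).trans (add_le_add (norm_pos_Lp_le haR hbR hWR k ht)
      (norm_pos_le a₀ b₀ (hi W₀) ht))
  set Γ : ℕ → ℝ → V := fun k t =>
    christoffel g (pos (a k) (b k) (W k) t) (vel (b k) (W k) t) (vel (b k) (W k) t) with hΓ
  set Γ₀ : ℝ → V := fun t => christoffel g (pos a₀ b₀ W₀ t) (vel b₀ W₀ t) (vel b₀ W₀ t) with hΓ₀
  have hΓc : ∀ k, Continuous (Γ k) := fun k => h.continuous_christoffel_curve _ _ (hi _)
  have hΓ₀c : Continuous Γ₀ := h.continuous_christoffel_curve _ _ (hi _)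
  set T := 3 * M * ‖ι‖ ^ 3 / c * (2 * R) ^ 2 with hT
  have hM := h.M_nonneg
  have hc := h.c_pos
  have hΓR : ∀ k t, ‖Γ k t‖ ≤ T := fun k t => (h.norm_christoffel_le _ _).trans (by
    rw [hT]
    gcongr
    exact hvR k t)
  have hΓlim : ∀ t ∈ Icc (0 : ℝ) 1, Tendsto (fun k => Γ k t) atTop (𝓝 (Γ₀ t)) := by
    intro t ht
    obtain ⟨C, hC, hlip⟩ := h.exists_christoffel_lip (max (2 * R) ‖vel b₀ W₀ t‖)
    rw [tendsto_iff_norm_sub_tendsto_zero]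
    have l1 := tendsto_iff_norm_sub_tendsto_zero.mp (hplim t ht)
    have l2 := tendsto_iff_norm_sub_tendsto_zero.mp
      ((hvlim t ht).map_compact hι fun k => hvR k t)
    refine squeeze_zero (fun _ => norm_nonneg _) (fun k => hlip _ _ _ _
      ((hvR k t).trans (le_max_left _ _)) (le_max_right _ _)) ?_
    simpa using (l1.add l2).const_mul C
  set Q := max (‖ι‖ * (3 * R + S)) (max ((2 * R) ^ 2) (2 * R ^ 2 + 2 * T ^ 2)) with hQ
  obtain ⟨A₁, hA₁, hA₁lim⟩ := h.fieldEnergy_lowerBound (R := Q)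
    (fun k => continuous_pos (a := a k) (b := b k) (hi (W k)))
    (continuous_pos (a := a₀) (b := b₀) (hi W₀)) (fun k => h.memL2_cov (a k) (b k) (memL2_Lp (W k)))
    (h.memL2_cov a₀ b₀ (memL2_Lp W₀)) (fun k t ht => (hpR k t ht).trans (le_max_left _ _))
    (fun k => by
      refine le_trans ?_ ((le_max_right _ _).trans (le_max_right _ _))
      have hw2 := (memL2_Lp (W k)).integrable_norm_sq
      calc ∫ t, ‖cov g (a k) (b k) (W k) t‖ ^ 2 ∂unitMeasure
          ≤ ∫ t, (2 * ‖W k t‖ ^ 2 + 2 * T ^ 2) ∂unitMeasure := by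
            refine integral_mono (h.memL2_cov _ _ (memL2_Lp (W k))).integrable_norm_sq
              ((hw2.const_mul 2).add (integrable_const _)) fun t => ?_
            have e1 : ‖cov g (a k) (b k) (W k) t‖ ≤ ‖W k t‖ + T :=
              (norm_add_le _ _).trans (add_le_add_right (hΓR k t) _)
            have e2 := pow_le_pow_left₀ (norm_nonneg _) e1 2
            simp only
            nlinarith [sq_nonneg (‖W k t‖ - T)]
        _ = 2 * ‖W k‖ ^ 2 + 2 * T ^ 2 := by
            rw [integral_add (hw2.const_mul 2) (integrable_const _), integral_const_mul,
              integral_norm_sq_Lp]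
            simp
        _ ≤ 2 * R ^ 2 + 2 * T ^ 2 := by gcongr; exact hWR k)
    hplim (fun f hf => by
      have hf' : MemLp f 2 unitMeasure := hf
      have hfi := hf.integrable
      have e : ∀ (U : Lp V 2 unitMeasure) (G : ℝ → V), Continuous G →
          ∫ t, inner ℝ (f t) (U t + G t) ∂unitMeasure = inner ℝ (MemLp.toLp f hf') U +
            ∫ t, inner ℝ (f t) (G t) ∂unitMeasure := by
        intro U G hG
        have i1 : Integrable (fun t => inner ℝ (f t) (U t)) unitMeasure :=
          MemL2.integrable_inner hf (memL2_Lp U)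
        have i2 : Integrable (fun t => inner ℝ (f t) (G t)) unitMeasure :=
          MemL2.integrable_inner hf (memL2_of_continuous hG)
        simp only [inner_add_right]
        rw [integral_add i1 i2, L2.inner_def]
        congr 1
        refine integral_congr_ae ?_
        filter_upwards [MemLp.coeFn_toLp hf'] with t ht
        rw [ht]
      have e₀ : ∫ t, inner ℝ (f t) (cov g a₀ b₀ W₀ t) ∂unitMeasure = _ := e W₀ Γ₀ hΓ₀c
      rw [e₀]
      refine Tendsto.congr (fun k => (e (W k) (Γ k) (hΓc k)).symm) ?_
      refine (hW _).add (tendsto_integral_of_dominated_convergence (fun t => ‖f t‖ * T)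
        (fun k => hf.1.inner (hΓc k).aestronglyMeasurable) (hfi.norm.mul_const T)
        (fun k => Eventually.of_forall fun t => (norm_inner_le_norm _ _).trans
          (mul_le_mul_of_nonneg_left (hΓR k t) (norm_nonneg _))) ?_)
      filter_upwards [ae_unitMeasure_mem] with t ht
      exact tendsto_const_nhds.inner (hΓlim t (Ioo_subset_Icc_self ht)))
  obtain ⟨A₂, hA₂, hA₂lim⟩ := h.fieldEnergy_lowerBound (R := Q)
    (fun k => continuous_pos (a := a k) (b := b k) (hi (W k)))
    (continuous_pos (a := a₀) (b := b₀) (hi W₀)) hv2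
    (memL2_of_continuous (continuous_vel (b := b₀) (hi W₀)))
    (fun k t ht => (hpR k t ht).trans (le_max_left _ _))
    (fun k => by
      refine le_trans ?_ ((le_max_left _ _).trans (le_max_right _ _))
      calc ∫ t, ‖vel (b k) (W k) t‖ ^ 2 ∂unitMeasure ≤ ∫ t, (2 * R) ^ 2 ∂unitMeasure :=
            integral_mono (hv2 k).integrable_norm_sq (integrable_const _)
              fun t => pow_le_pow_left₀ (norm_nonneg _) (hvR k t) 2
        _ = (2 * R) ^ 2 := by simp)
    hplim (fun f hf => by
      refine tendsto_integral_of_dominated_convergence (fun t => ‖f t‖ * (2 * R))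
        (fun k => hf.1.inner (hvc k).aestronglyMeasurable) (hf.integrable.norm.mul_const _)
        (fun k => Eventually.of_forall fun t => (norm_inner_le_norm _ _).trans
          (mul_le_mul_of_nonneg_left (hvR k t) (norm_nonneg _))) ?_
      filter_upwards [ae_unitMeasure_mem] with t ht
      exact hvlim t (Ioo_subset_Icc_self ht) (f t))
  exact ⟨fun k => A₁ k + σ * A₂ k, fun k => add_le_add (hA₁ k)
    (mul_le_mul_of_nonneg_left (hA₂ k) hσ), hA₁lim.add (hA₂lim.const_mul σ)⟩

end Energy

/-! ### Existence of minimizers -/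

section Existence

variable {V Y : Type*} [NormedAddCommGroup V] [InnerProductSpace ℝ V] [CompleteSpace V]
  [NormedAddCommGroup Y] [NormedSpace ℝ Y] {ι : V →L[ℝ] Y} {g : V → V →L[ℝ] V →L[ℝ] ℝ} {c M : ℝ}

omit [InnerProductSpace ℝ V] [CompleteSpace V] in
theorem MemL2.integral_norm_le_one_add {w : ℝ → V} (hw : MemL2 w) :
    ∫ t, ‖w t‖ ∂unitMeasure ≤ 1 + ∫ t, ‖w t‖ ^ 2 ∂unitMeasure := by
  calc ∫ t, ‖w t‖ ∂unitMeasure ≤ ∫ t, (1 + ‖w t‖ ^ 2) ∂unitMeasure :=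
        integral_mono hw.integrable.norm ((integrable_const 1).add hw.integrable_norm_sq)
          fun t => by simp only; nlinarith [sq_nonneg (‖w t‖ - 1)]
    _ = 1 + ∫ t, ‖w t‖ ^ 2 ∂unitMeasure := by
        rw [integral_add (integrable_const 1) hw.integrable_norm_sq]
        simp

/-- A priori bounds. The `L¹` norm of the acceleration is controlled by that of the covariant
acceleration and by the squared `L²` norm of the velocity, because the Christoffel operator is
quadratic in the velocity; this bounds the velocity uniformly and then the acceleration in `L²`. -/
theorem MetricBounds.exists_bound (h : MetricBounds ι g c M) (K t₀ : ℝ)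
    (ht₀ : t₀ ∈ Icc (0 : ℝ) 1) (p : V) :
    ∃ R, ∀ (a b : V) (W : Lp V 2 unitMeasure), pos a b W t₀ = p →
      fieldEnergy g (pos a b W) (cov g a b W) ≤ K → fieldEnergy g (pos a b W) (vel b W) ≤ K →
      ‖a‖ ≤ R ∧ ‖b‖ ≤ R ∧ ‖W‖ ≤ R := by
  have hc := h.c_pos
  have hM := h.M_nonneg
  set C := 3 * M * ‖ι‖ ^ 3 / c with hC
  have hC0 : 0 ≤ C := by positivity
  -- bounds for the acceleration in `L¹`, for the velocity in `L∞`, for the acceleration in `L²`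
  set R₁ := 1 + K / c + C * (K / c) with hR₁
  set R₂ := 1 + K / c + R₁ + R₁ with hR₂
  set R₃ := √(2 * (K / c) + 2 * (C * R₂ ^ 2) ^ 2) with hR₃
  refine ⟨max (‖p‖ + R₂) (max (1 + K / c + R₁) R₃), fun a b W hp hF hE => ?_⟩
  have hW2 := memL2_Lp W
  have hWi := hW2.integrable
  have hvc : Continuous (vel b W) := continuous_vel hWi
  have hv2 := memL2_of_continuous hvc
  have hcov2 := h.memL2_cov a b hW2
  have hpc : Continuous (pos a b W) := continuous_pos hWi
  have hv : ∫ t, ‖vel b W t‖ ^ 2 ∂unitMeasure ≤ K / c :=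
    (h.integral_norm_sq_le hpc hv2).trans (by gcongr)
  have hcov : ∫ t, ‖cov g a b W t‖ ^ 2 ∂unitMeasure ≤ K / c :=
    (h.integral_norm_sq_le hpc hcov2).trans (by gcongr)
  have hpt : ∀ t, ‖W t‖ ≤ ‖cov g a b W t‖ + C * ‖vel b W t‖ ^ 2 := by
    intro t
    have e : W t = cov g a b W t -
        christoffel g (pos a b W t) (vel b W t) (vel b W t) := by
      rw [cov, add_sub_cancel_right]
    calc ‖W t‖ ≤ ‖cov g a b W t‖ + ‖christoffel g (pos a b W t) (vel b W t) (vel b W t)‖ := by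
          conv_lhs => rw [e]
          exact norm_sub_le _ _
      _ ≤ _ := add_le_add_right (h.norm_christoffel_le _ _) _
  have hW1 : ∫ t, ‖W t‖ ∂unitMeasure ≤ R₁ := by
    calc ∫ t, ‖W t‖ ∂unitMeasure
        ≤ ∫ t, (‖cov g a b W t‖ + C * ‖vel b W t‖ ^ 2) ∂unitMeasure :=
          integral_mono hWi.norm
            (hcov2.integrable.norm.add (hv2.integrable_norm_sq.const_mul C)) hpt
      _ = ∫ t, ‖cov g a b W t‖ ∂unitMeasure + C * ∫ t, ‖vel b W t‖ ^ 2 ∂unitMeasure := by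
          rw [integral_add hcov2.integrable.norm (hv2.integrable_norm_sq.const_mul C),
            integral_const_mul]
      _ ≤ R₁ := by
          have := hcov2.integral_norm_le_one_add
          have := mul_le_mul_of_nonneg_left hv hC0
          linarith
  have hbR : ‖b‖ ≤ 1 + K / c + R₁ := by
    have e : ∀ t, ‖b‖ ≤ ‖vel b W t‖ + R₁ := by
      intro t
      have e1 : b = vel b W t - ∫ s in (0 : ℝ)..t, W s ∂unitMeasure := by
        rw [vel, add_sub_cancel_right]
      calc ‖b‖ ≤ ‖vel b W t‖ + ‖∫ s in (0 : ℝ)..t, W s ∂unitMeasure‖ := by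
            conv_lhs => rw [e1]
            exact norm_sub_le _ _
        _ ≤ _ := add_le_add_right ((norm_primitive_le hWi 0 t).trans hW1) _
    have e2 := integral_mono (integrable_const _)
      (hv2.integrable.norm.add (integrable_const R₁)) e
    rw [integral_add' hv2.integrable.norm (integrable_const R₁)] at e2
    simp only [integral_const, measureReal_restrict_apply, MeasurableSet.univ, univ_inter,
      Real.volume_real_Ioo_of_le zero_le_one, sub_zero, one_smul] at e2
    linarith [hv2.integral_norm_le_one_add]
  have hvR : ∀ t, ‖vel b W t‖ ≤ R₂ := fun t => (norm_vel_le b hWi t).trans (by linarith)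
  have hR₂0 : 0 ≤ R₂ := (norm_nonneg _).trans (hvR 0)
  have haR : ‖a‖ ≤ ‖p‖ + R₂ := by
    have e1 : a = p - ∫ s in (0 : ℝ)..t₀, vel b W s := by rw [← hp, pos, add_sub_cancel_right]
    rw [e1]
    refine (norm_sub_le _ _).trans (add_le_add_right ?_ _)
    refine (intervalIntegral.norm_integral_le_of_norm_le_const fun s _ => hvR s).trans ?_
    rw [sub_zero, abs_of_nonneg ht₀.1]
    exact mul_le_of_le_one_right hR₂0 ht₀.2
  have hWR : ‖W‖ ≤ R₃ := by
    refine Real.le_sqrt_of_sq_le ?_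
    rw [← integral_norm_sq_Lp]
    calc ∫ t, ‖W t‖ ^ 2 ∂unitMeasure
        ≤ ∫ t, (2 * ‖cov g a b W t‖ ^ 2 + 2 * (C * R₂ ^ 2) ^ 2) ∂unitMeasure := by
          refine integral_mono hW2.integrable_norm_sq
            ((hcov2.integrable_norm_sq.const_mul 2).add (integrable_const _)) fun t => ?_
          have e1 : ‖W t‖ ≤ ‖cov g a b W t‖ + C * R₂ ^ 2 := (hpt t).trans (by
            gcongr
            exact hvR t)
          have e2 := pow_le_pow_left₀ (norm_nonneg _) e1 2
          simp only
          nlinarith [sq_nonneg (‖cov g a b W t‖ - C * R₂ ^ 2)]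
      _ = 2 * (∫ t, ‖cov g a b W t‖ ^ 2 ∂unitMeasure) + 2 * (C * R₂ ^ 2) ^ 2 := by
          rw [integral_add (hcov2.integrable_norm_sq.const_mul 2) (integrable_const _),
            integral_const_mul]
          simp
      _ ≤ _ := by linarith
  exact ⟨haR.trans (le_max_left _ _), hbR.trans ((le_max_left _ _).trans (le_max_right _ _)),
    hWR.trans ((le_max_right _ _).trans (le_max_right _ _))⟩

omit [CompleteSpace V] in
/-- Hermite interpolation: smooth curves with prescribed values and derivatives at finitely many
points. -/
theorem exists_hermite_interpolation (S : Finset ℝ) (q v : ℝ → V) :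
    ∃ y : ℝ → V, ContDiff ℝ ∞ y ∧ ∀ s ∈ S, y s = q s ∧ deriv y s = v s := by
  classical
  induction S using Finset.induction_on with
  | empty => exact ⟨fun _ => 0, contDiff_const, by simp⟩
  | insert s S hs ih =>
    obtain ⟨y, hy, hyS⟩ := ih
    -- `P ^ 2` vanishes to second order at the old nodes and not at the new one
    set P : ℝ → ℝ := fun x => ∏ r ∈ S, (x - r) with hP
    have hPd : ContDiff ℝ ∞ P := contDiff_prod fun r _ => contDiff_id.sub contDiff_const
    have hPs : P s ≠ 0 := Finset.prod_ne_zero_iff.mpr fun r hr =>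
      sub_ne_zero.mpr fun h => hs (h ▸ hr)
    have hP0 : ∀ r ∈ S, P r = 0 := fun r hr => Finset.prod_eq_zero hr (sub_self r)
    set α : V := (P s ^ 2)⁻¹ • (q s - y s) with hα
    set β : V := (P s ^ 2)⁻¹ • (v s - deriv y s - (2 * P s * deriv P s) • α) with hβ
    have hdiff : ∀ x, HasDerivAt (fun x => y x + P x ^ 2 • (α + (x - s) • β))
        (deriv y x + (P x ^ 2 • β + (2 * P x * deriv P x) • (α + (x - s) • β))) x := by
      intro x
      have h1 := (hy.differentiable (by simp) x).hasDerivAt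
      have h2 := ((hPd.differentiable (by simp) x).hasDerivAt).pow 2
      have h3 : HasDerivAt (fun x : ℝ => α + (x - s) • β) β x := by
        simpa using (((hasDerivAt_id x).sub_const s).smul_const β).const_add α
      have h4 := h1.add (h2.smul h3)
      simp only [Nat.cast_ofNat, Nat.add_one_sub_one, pow_one] at h4
      exact h4
    refine ⟨fun x => y x + P x ^ 2 • (α + (x - s) • β), ?_, fun r hr => ?_⟩
    · exact hy.add ((hPd.pow 2).smul (contDiff_const.add
        ((contDiff_id.sub contDiff_const).smul contDiff_const)))
    rw [(hdiff r).deriv]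
    rcases Finset.mem_insert.mp hr with rfl | hr
    · have hP2 : P r ^ 2 ≠ 0 := pow_ne_zero 2 hPs
      constructor
      · change y r + P r ^ 2 • (α + (r - r) • β) = q r
        rw [sub_self, zero_smul, add_zero, hα, smul_inv_smul₀ hP2, add_sub_cancel]
      · rw [sub_self, zero_smul, add_zero, hβ, smul_inv_smul₀ hP2]
        abel
    · simp [hP0 r hr, hyS r hr]

/-- A smooth curve is the double primitive of its second derivative. -/
theorem eqOn_pos_of_contDiff {y : ℝ → V} (hy : ContDiff ℝ ∞ y) :
    EqOn y (pos (y 0) (deriv y 0) (deriv (deriv y))) (Icc 0 1) := by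
  have h1 : ContDiff ℝ ∞ (deriv y) := (contDiff_infty_iff_deriv.mp hy).2
  have h2 : Continuous (deriv (deriv y)) := h1.continuous_deriv (by simp)
  have e1 : EqOn (vel (deriv y 0) (deriv (deriv y))) (deriv y) (Icc 0 1) := by
    intro t ht
    rw [vel, intervalIntegral_unitMeasure _ (left_mem_Icc.mpr zero_le_one) ht,
      intervalIntegral.integral_deriv_eq_sub
        (fun x _ => (h1.differentiable (by simp)).differentiableAt) (h2.intervalIntegrable _ _),
      add_sub_cancel]
  intro t ht
  have e2 : ∫ s in (0 : ℝ)..t, vel (deriv y 0) (deriv (deriv y)) s =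
      ∫ s in (0 : ℝ)..t, deriv y s := by
    refine intervalIntegral.integral_congr fun s hs => e1 ?_
    rw [uIcc_of_le ht.1] at hs
    exact ⟨hs.1, hs.2.trans ht.2⟩
  rw [pos, e2, intervalIntegral.integral_deriv_eq_sub
    (fun x _ => (hy.differentiable (by simp)).differentiableAt)
    (h1.continuous.intervalIntegrable _ _), add_sub_cancel]

theorem exists_isCompetitor {n : ℕ} (t : Fin (n + 1) → ℝ) (ht : ∀ i, t i ∈ Icc (0 : ℝ) 1)
    (ht_mono : StrictMono t) (p : Fin (n + 1) → V) (bc : BoundaryCondition V)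
    (hbc : bc.Compatible t) : ∃ y : ℝ → V, IsCompetitor t p bc y := by
  classical
  have hinv : ∀ i, Function.invFun t (t i) = i := Function.leftInverse_invFun ht_mono.injective
  -- A smooth curve is a competitor as soon as its values and derivatives at the nodes and at the
  -- end points are right.
  have main : ∀ (q v : ℝ → V), (∀ i, q (t i) = p i) →
      (∀ y : ℝ → V, y 0 = q 0 → y 1 = q 1 → velocity y 0 = v 0 → velocity y 1 = v 1 →
        bc.Holds y) → ∃ y : ℝ → V, IsCompetitor t p bc y := by
    intro q v hq hB
    obtain ⟨y, hy, hyS⟩ := exists_hermite_interpolation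
      (insert 0 (insert 1 (Finset.univ.image t))) q v
    have hrep := eqOn_pos_of_contDiff hy
    have hw2 : MemL2 (deriv (deriv y)) := memL2_of_continuous
      ((contDiff_infty_iff_deriv.mp hy).2.continuous_deriv (by simp))
    have hvel : ∀ s ∈ Icc (0 : ℝ) 1, velocity y s = deriv y s := fun s hs =>
      (hy.differentiable (by simp) s).hasDerivAt.hasDerivWithinAt.derivWithin
        (uniqueDiffOn_Icc zero_lt_one s hs)
    have h0 := hyS 0 (by simp)
    have h1 := hyS 1 (by simp)
    refine ⟨y, memW22_of_eqOn_pos hw2 hrep, fun i => ?_, hB y h0.1 h1.1 ?_ ?_⟩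
    · rw [(hyS (t i) (by simp)).1, hq]
    · rw [hvel 0 (left_mem_Icc.mpr zero_le_one), h0.2]
    · rw [hvel 1 (right_mem_Icc.mpr zero_le_one), h1.2]
  cases bc with
  | natural =>
    exact main (fun s => p (Function.invFun t s)) 0 (fun i => by rw [hinv]) fun _ _ _ _ _ => trivial
  | hermite v₀ v₁ =>
    refine main (fun s => p (Function.invFun t s)) (fun s => if s = 0 then v₀ else v₁)
      (fun i => by rw [hinv]) fun y _ _ h0 h1 => ⟨by simpa using h0, by simpa using h1⟩
  | periodic =>
    rcases hbc with h0 | h1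
    · -- `0` is not a node, so the value there can be chosen
      have hne : ∀ i, t i ≠ 0 := fun i =>
        (lt_of_lt_of_le (lt_of_le_of_ne (ht 0).1 (Ne.symm h0))
          (ht_mono.monotone (Fin.zero_le i))).ne'
      refine main (fun s => p (Function.invFun t (if s = 0 then 1 else s))) 0
        (fun i => by rw [if_neg (hne i), hinv]) fun y e0 e1 d0 d1 => ⟨?_, ?_⟩
      · rw [e0, e1]; simp
      · rw [d0, d1]; simp
    · have hne : ∀ i, t i ≠ 1 := fun i =>
        (lt_of_le_of_lt (ht_mono.monotone (Fin.le_last i))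
          (lt_of_le_of_ne (ht (Fin.last n)).2 h1)).ne
      refine main (fun s => p (Function.invFun t (if s = 1 then 0 else s))) 0
        (fun i => by rw [if_neg (hne i), hinv]) fun y e0 e1 d0 d1 => ⟨?_, ?_⟩
      · rw [e0, e1]; simp
      · rw [d0, d1]; simp

theorem MetricBounds.regSplineEnergy_nonneg (h : MetricBounds ι g c M) {σ : ℝ} (hσ : 0 ≤ σ)
    {y : ℝ → V} (hy : MemW22 y) : 0 ≤ regSplineEnergy g σ y := by
  obtain ⟨a, b, w, hw, he⟩ := hy.exists_eqOn_pos
  rw [regSplineEnergy_eq σ hw he]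
  exact add_nonneg (h.fieldEnergy_nonneg _ _) (mul_nonneg hσ (h.fieldEnergy_nonneg _ _))

/-- The boundary condition in terms of the representation of the curve by its acceleration. -/
theorem BoundaryCondition.holds_congr (bc : BoundaryCondition V) {y : ℝ → V} {a b : V} {w : ℝ → V}
    (hw : Integrable w unitMeasure) (h : EqOn y (pos a b w) (Icc 0 1)) :
    bc.Holds y ↔ bc.Holds (pos a b w) := by
  have h0 : (0 : ℝ) ∈ Icc (0 : ℝ) 1 := left_mem_Icc.mpr zero_le_one
  have h1 : (1 : ℝ) ∈ Icc (0 : ℝ) 1 := right_mem_Icc.mpr zero_le_one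
  have e := velocity_eqOn_vel hw h
  have e' := velocity_eqOn_vel hw (fun t _ => rfl : EqOn (pos a b w) (pos a b w) (Icc 0 1))
  cases bc <;>
    simp only [BoundaryCondition.Holds, h h0, h h1, e h0, e h1, e' h0, e' h1]

/-- Boundary conditions are preserved under pointwise weak convergence of position and velocity. -/
theorem BoundaryCondition.holds_of_weakTendsto (bc : BoundaryCondition V) {a b : ℕ → V} {a₀ b₀ : V}
    {W : ℕ → Lp V 2 unitMeasure} {W₀ : Lp V 2 unitMeasure}
    (hp : ∀ t ∈ Icc (0 : ℝ) 1, WeakTendsto (fun k => pos (a k) (b k) (W k) t) (pos a₀ b₀ W₀ t))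
    (hv : ∀ t ∈ Icc (0 : ℝ) 1, WeakTendsto (fun k => vel (b k) (W k) t) (vel b₀ W₀ t))
    (h : ∀ k, bc.Holds (pos (a k) (b k) (W k))) : bc.Holds (pos a₀ b₀ W₀) := by
  have h0 : (0 : ℝ) ∈ Icc (0 : ℝ) 1 := left_mem_Icc.mpr zero_le_one
  have h1 : (1 : ℝ) ∈ Icc (0 : ℝ) 1 := right_mem_Icc.mpr zero_le_one
  have e : ∀ (a b : V) (U : Lp V 2 unitMeasure), EqOn (velocity (pos a b U)) (vel b U) (Icc 0 1) :=
    fun a b U => velocity_eqOn_vel (memL2_Lp U).integrable fun _ _ => rfl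
  cases bc with
  | natural => trivial
  | hermite v₀ v₁ =>
    simp only [BoundaryCondition.Holds, e _ _ _ h0, e _ _ _ h1] at h ⊢
    refine ⟨(hv 0 h0).unique ?_, (hv 1 h1).unique ?_⟩
    · simp only [fun k => (h k).1]
      exact weakTendsto_const v₀
    · simp only [fun k => (h k).2]
      exact weakTendsto_const v₁
  | periodic =>
    simp only [BoundaryCondition.Holds, e _ _ _ h0, e _ _ _ h1] at h ⊢
    refine ⟨(hp 0 h0).unique ?_, (hv 0 h0).unique ?_⟩
    · simp only [fun k => (h k).1]
      exact hp 1 h1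
    · simp only [fun k => (h k).2]
      exact hv 1 h1

/-- Existence of spline interpolations by the direct method. -/
theorem MetricBounds.exists_isSplineInterpolation [TopologicalSpace.SeparableSpace V]
    (h : MetricBounds ι g c M) (hι : IsCompactOperator ι) {σ : ℝ} (hσ : 0 < σ)
    {n : ℕ} {t : Fin (n + 1) → ℝ} (ht : ∀ i, t i ∈ Icc (0 : ℝ) 1) {p : Fin (n + 1) → V}
    {bc : BoundaryCondition V} (hne : ∃ y : ℝ → V, IsCompetitor t p bc y) :
    ∃ y : ℝ → V, IsSplineInterpolation g σ t p bc y := by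
  have : Fact ((2 : ENNReal) ≠ ⊤) := ⟨by simp⟩
  set E : Set ℝ := regSplineEnergy g σ '' {y | IsCompetitor t p bc y} with hE
  have hEne : E.Nonempty := Set.Nonempty.image _ hne
  have hEbdd : BddBelow E := ⟨0, by
    rintro _ ⟨y, hy, rfl⟩
    exact h.regSplineEnergy_nonneg hσ.le hy.1⟩
  obtain ⟨e, heanti, helim, heE⟩ := exists_seq_tendsto_sInf hEne hEbdd
  choose y hy hye using heE
  choose a b W hrep using fun k => (hy k).1.exists_eqOn_pos_Lp
  have hen : ∀ k, e k = fieldEnergy g (pos (a k) (b k) (W k)) (cov g (a k) (b k) (W k)) +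
      σ * fieldEnergy g (pos (a k) (b k) (W k)) (vel (b k) (W k)) := fun k => by
    rw [← hye k, regSplineEnergy_eq σ (memL2_Lp (W k)) (hrep k)]
  -- both summands of the energy are nonnegative, so each of them is bounded along the sequence
  obtain ⟨R, hR⟩ := h.exists_bound (max (e 0) (e 0 / σ)) (t 0) (ht 0) (p 0)
  have hbd : ∀ k, ‖a k‖ ≤ R ∧ ‖b k‖ ≤ R ∧ ‖W k‖ ≤ R := by
    intro k
    have hF := h.fieldEnergy_nonneg (pos (a k) (b k) (W k)) (cov g (a k) (b k) (W k))
    have hE' := h.fieldEnergy_nonneg (pos (a k) (b k) (W k)) (vel (b k) (W k))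
    have h0 : e k ≤ e 0 := heanti (Nat.zero_le k)
    have hEσ := mul_nonneg hσ.le hE'
    refine hR _ _ _ ?_ ?_ ?_
    · rw [← hrep k (ht 0)]
      exact (hy k).2.1 0
    · exact le_trans (by linarith [hen k]) (le_max_left _ _)
    · refine le_trans ?_ (le_max_right _ _)
      rw [le_div_iff₀ hσ]
      linarith [hen k]
  obtain ⟨a₀, φ₁, hφ₁, ha⟩ := exists_weakTendsto_subseq fun k => (hbd k).1
  obtain ⟨b₀, φ₂, hφ₂, hb⟩ := exists_weakTendsto_subseq fun k => (hbd (φ₁ k)).2.1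
  obtain ⟨W₀, φ₃, hφ₃, hW⟩ := exists_weakTendsto_subseq fun k => (hbd (φ₁ (φ₂ k))).2.2
  set φ : ℕ → ℕ := fun k => φ₁ (φ₂ (φ₃ k)) with hφ
  have hφm : StrictMono φ := hφ₁.comp (hφ₂.comp hφ₃)
  have ha' : WeakTendsto (fun k => a (φ k)) a₀ := ha.comp (hφ₂.comp hφ₃)
  have hb' : WeakTendsto (fun k => b (φ k)) b₀ := hb.comp hφ₃
  have hW' : WeakTendsto (fun k => W (φ k)) W₀ := hW
  have hp : ∀ s ∈ Icc (0 : ℝ) 1,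
      WeakTendsto (fun k => pos (a (φ k)) (b (φ k)) (W (φ k)) s) (pos a₀ b₀ W₀ s) := fun s hs =>
    WeakTendsto.pos ha' hb' hW' (fun k => (hbd (φ k)).2.1) (fun k => (hbd (φ k)).2.2) hs.1
  have hv : ∀ s ∈ Icc (0 : ℝ) 1,
      WeakTendsto (fun k => vel (b (φ k)) (W (φ k)) s) (vel b₀ W₀ s) := fun s hs =>
    WeakTendsto.vel hb' hW' hs.1
  have hrefl : EqOn (pos a₀ b₀ W₀) (pos a₀ b₀ W₀) (Icc 0 1) := fun _ _ => rfl
  have hcomp : IsCompetitor t p bc (pos a₀ b₀ W₀) := by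
    refine ⟨memW22_of_eqOn_pos (memL2_Lp W₀) hrefl, fun i => ?_,
      bc.holds_of_weakTendsto hp hv fun k =>
        (bc.holds_congr (memL2_Lp (W (φ k))).integrable (hrep (φ k))).mp (hy (φ k)).2.2⟩
    refine (hp (t i) (ht i)).unique ?_
    have : ∀ k, pos (a (φ k)) (b (φ k)) (W (φ k)) (t i) = p i := fun k => by
      rw [← hrep (φ k) (ht i)]
      exact (hy (φ k)).2.1 i
    simp only [this]
    exact weakTendsto_const (p i)
  refine ⟨_, hcomp, fun z hz => ?_⟩
  obtain ⟨A, hA, hAlim⟩ := h.energy_lowerBound hι hσ.le ha' hb' hW' (fun k => (hbd (φ k)).1)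
    (fun k => (hbd (φ k)).2.1) (fun k => (hbd (φ k)).2.2)
  rw [← regSplineEnergy_eq σ (memL2_Lp W₀) hrefl] at hAlim
  have hle : regSplineEnergy g σ (pos a₀ b₀ W₀) ≤ sInf E :=
    le_of_tendsto_of_tendsto' hAlim (helim.comp hφm.tendsto_atTop)
      fun k => (hA k).trans_eq (hen (φ k)).symm
  exact hle.trans (csInf_le hEbdd ⟨z, hz, rfl⟩)

end Existence

/-! ### Regularity of solutions of weak equations -/

section Duality

/-- If a functional `⟪G, ·⟫` on a subspace `N` is bounded by the seminorm `‖S ·‖`, then it factors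
through `S`: by the Hahn–Banach and Riesz theorems it equals `⟪h, S ·⟫` on `N` for some `h`. -/
theorem exists_inner_eq_inner_comp {H H' : Type*} [NormedAddCommGroup H] [InnerProductSpace ℝ H]
    [NormedAddCommGroup H'] [InnerProductSpace ℝ H'] [CompleteSpace H'] (S : H →ₗ[ℝ] H')
    (N : Submodule ℝ H) (G : H) {K : ℝ} (hK : ∀ x ∈ N, |inner ℝ G x| ≤ K * ‖S x‖) :
    ∃ h : H', ∀ x ∈ N, inner ℝ G x = inner ℝ h (S x) := by
  set T : N →ₗ[ℝ] H' := S.comp N.subtype with hT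
  obtain ⟨r, hr⟩ := T.rangeRestrict.exists_rightInverse_of_surjective
    T.range_rangeRestrict
  have hr' : ∀ y : LinearMap.range T, T (r y) = y := fun y => by
    have := congrArg Subtype.val (LinearMap.congr_fun hr y)
    simpa using this
  set ℓ : LinearMap.range T →ₗ[ℝ] ℝ := (innerₛₗ ℝ G).comp (N.subtype.comp r) with hℓ
  have hb : ∀ y : LinearMap.range T, ‖ℓ y‖ ≤ K * ‖y‖ := by
    intro y
    refine (hK (r y) (r y).2).trans_eq ?_
    change K * ‖T (r y)‖ = _
    rw [hr', Submodule.coe_norm]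
  obtain ⟨F, hF, -⟩ := exists_extension_norm_eq (LinearMap.range T) (ℓ.mkContinuous K hb)
  refine ⟨(InnerProductSpace.toDual ℝ H').symm F, fun x hx => ?_⟩
  rw [InnerProductSpace.toDual_symm_apply]
  have h1 := hF ⟨T ⟨x, hx⟩, LinearMap.mem_range_self _ _⟩
  have h2 : F (S x) = F (T ⟨x, hx⟩) := rfl
  rw [h2, h1]
  set y : LinearMap.range T := ⟨T ⟨x, hx⟩, LinearMap.mem_range_self _ _⟩ with hy
  change inner ℝ G x = inner ℝ G (r y : H)
  have h3 := hK (x - r y) (N.sub_mem hx (r y).2)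
  have h4 : S (x - r y) = 0 := by
    rw [map_sub, sub_eq_zero]
    exact (hr' y).symm
  rw [h4, norm_zero, mul_zero, inner_sub_right] at h3
  exact sub_eq_zero.mp (abs_nonpos_iff.mp h3)

variable {V : Type*} [NormedAddCommGroup V] [InnerProductSpace ℝ V] [CompleteSpace V]

omit [CompleteSpace V] in
theorem integrable_smul_of_memL2 {e : ℝ → ℝ} (he : MemLp e 2 unitMeasure) {w : ℝ → V}
    (hw : MemL2 w) : Integrable (fun t => e t • w t) unitMeasure :=
  Integrable.mono' (MemLp.integrable_mul (MemLp.norm he) (MemLp.norm hw)) (he.1.smul hw.1)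
    (Eventually.of_forall fun _ => (norm_smul _ _).le)

omit [CompleteSpace V] in
theorem memL2_smul_const {e : ℝ → ℝ} (he : MemLp e 2 unitMeasure) (v : V) :
    MemL2 fun t => e t • v :=
  (ContinuousLinearMap.toSpanSingleton ℝ v).comp_memLp' he

omit [CompleteSpace V] in
theorem ae_eq_zero_of_integral_inner_eq_zero {G : ℝ → V} (hG : MemL2 G)
    (h : ∀ w : ℝ → V, MemL2 w → ∫ t, inner ℝ (G t) (w t) ∂unitMeasure = 0) :
    G =ᵐ[unitMeasure] 0 := by
  have h1 := h G hG
  simp only [real_inner_self_eq_norm_sq] at h1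
  rw [integral_eq_zero_iff_of_nonneg (fun t => sq_nonneg _) hG.integrable_norm_sq] at h1
  filter_upwards [h1] with t ht
  simpa using ht

/-- Lagrange multipliers for moment conditions: a field that is orthogonal to all fields with
vanishing moments against finitely many functions is a combination of these functions with constant
vector coefficients. -/
theorem exists_ae_eq_sum_of_moments {κ : Type*} (e : κ → ℝ → ℝ)
    (he : ∀ k, MemLp (e k) 2 unitMeasure) (s : Finset κ) {G : ℝ → V} (hG : MemL2 G)
    (h : ∀ w : ℝ → V, MemL2 w → (∀ k ∈ s, ∫ t, e k t • w t ∂unitMeasure = 0) →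
      ∫ t, inner ℝ (G t) (w t) ∂unitMeasure = 0) :
    ∃ d : κ → V, ∀ᵐ t ∂unitMeasure, G t = ∑ k ∈ s, e k t • d k := by
  classical
  induction s using Finset.induction_on generalizing G with
  | empty =>
    refine ⟨0, ?_⟩
    filter_upwards [ae_eq_zero_of_integral_inner_eq_zero hG fun w hw => h w hw (by simp)] with t ht
    simpa using ht
  | insert k s hk ih =>
    by_cases hη : ∃ η : ℝ → ℝ, MemLp η 2 unitMeasure ∧
        (∀ j ∈ s, ∫ t, e j t * η t ∂unitMeasure = 0) ∧ ∫ t, e k t * η t ∂unitMeasure ≠ 0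
    · -- correcting a field along `η` makes its moment against `e k` vanish
      obtain ⟨η, hη2, hηs, hηk⟩ := hη
      set m := ∫ t, e k t * η t ∂unitMeasure with hm
      have hηG := integrable_smul_of_memL2 hη2 hG
      set d₀ : V := m⁻¹ • ∫ t, η t • G t ∂unitMeasure with hd₀
      have hed : MemL2 fun t => e k t • d₀ := memL2_smul_const (he k) d₀
      obtain ⟨d, hd⟩ := ih (G := fun t => G t - e k t • d₀) (MemLp.sub hG hed) (by
        intro w hw hws
        set I : V := ∫ t, e k t • w t ∂unitMeasure with hI
        have hηI : MemL2 fun t => η t • (m⁻¹ • I) := memL2_smul_const hη2 _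
        have horth := h (fun t => w t - η t • (m⁻¹ • I)) (MemLp.sub hw hηI) (by
          intro j hj
          have i1 := integrable_smul_of_memL2 (he j) hw
          have i2 := integrable_smul_of_memL2 (he j) hηI
          simp only [smul_sub]
          rw [integral_sub i1 i2]
          simp only [smul_smul (e j _)]
          rw [integral_smul_const]
          rcases Finset.mem_insert.mp hj with rfl | hj
          · rw [← hm, smul_inv_smul₀ hηk, ← hI, sub_self]
          · rw [hws j hj, hηs j hj, zero_smul, sub_self])
        simp only [inner_sub_right, inner_sub_left] at horth ⊢
        rw [integral_sub (hG.integrable_inner hw) (hG.integrable_inner hηI)] at horth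
        rw [integral_sub (hG.integrable_inner hw) (hed.integrable_inner hw)]
        have e1 : ∫ t, inner ℝ (G t) (η t • (m⁻¹ • I)) ∂unitMeasure = inner ℝ d₀ I := by
          have : ∀ t, inner ℝ (G t) (η t • (m⁻¹ • I)) = inner ℝ (m⁻¹ • I) (η t • G t) :=
            fun t => by rw [real_inner_comm, inner_smul_left, inner_smul_right]; rfl
          simp only [this]
          rw [integral_inner hηG, hd₀, real_inner_comm, inner_smul_left, inner_smul_right]
          rfl
        have e2 : ∫ t, inner ℝ (e k t • d₀) (w t) ∂unitMeasure = inner ℝ d₀ I := by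
          have : ∀ t, inner ℝ (e k t • d₀) (w t) = inner ℝ d₀ (e k t • w t) :=
            fun t => by rw [inner_smul_left, inner_smul_right]; rfl
          simp only [this]
          rw [integral_inner (integrable_smul_of_memL2 (he k) hw)]
        rw [e2, ← e1]
        exact horth)
      refine ⟨Function.update d k d₀, ?_⟩
      filter_upwards [hd] with t ht
      rw [Finset.sum_insert hk, Function.update_self, ← sub_eq_iff_eq_add', ht]
      refine Finset.sum_congr rfl fun j hj => ?_
      rw [Function.update_of_ne (ne_of_mem_of_not_mem hj hk)]
    · -- the moment condition for `e k` follows from the other ones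
      push Not at hη
      obtain ⟨d, hd⟩ := ih hG (by
        intro w hw hws
        refine h w hw fun j hj => ?_
        rcases Finset.mem_insert.mp hj with rfl | hj
        · refine ext_inner_left ℝ fun z => ?_
          rw [← integral_inner (integrable_smul_of_memL2 (he j) hw), inner_zero_right]
          simp only [inner_smul_right]
          refine hη (fun t => inner ℝ z (w t)) (MemLp.const_inner z hw) fun i hi => ?_
          simp only [← inner_smul_right]
          rw [integral_inner (integrable_smul_of_memL2 (he i) hw), hws i hi, inner_zero_right]
        · exact hws j hj)
      refine ⟨Function.update d k 0, ?_⟩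
      filter_upwards [hd] with t ht
      rw [Finset.sum_insert hk, Function.update_self, smul_zero, zero_add, ht]
      refine Finset.sum_congr rfl fun j hj => ?_
      rw [Function.update_of_ne (ne_of_mem_of_not_mem hj hk)]

end Duality

section Holder

variable {V : Type*} [NormedAddCommGroup V] [InnerProductSpace ℝ V]

/-- Hölder continuity with exponent `1/2` on `[0,1]`. -/
def HolderHalf (f : ℝ → V) : Prop :=
  ∃ C : ℝ, 0 ≤ C ∧ ∀ s ∈ Icc (0 : ℝ) 1, ∀ t ∈ Icc (0 : ℝ) 1, ‖f t - f s‖ ≤ C * √|t - s|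

omit [InnerProductSpace ℝ V] in
theorem HolderHalf.continuousOn {f : ℝ → V} (h : HolderHalf f) : ContinuousOn f (Icc 0 1) := by
  obtain ⟨C, hC, hf⟩ := h
  intro s hs
  rw [ContinuousWithinAt, tendsto_iff_norm_sub_tendsto_zero]
  refine squeeze_zero' (Eventually.of_forall fun _ => norm_nonneg _)
    (eventually_mem_nhdsWithin.mono fun t ht => hf s hs t ht) ?_
  have hc : Continuous fun t : ℝ => C * √|t - s| := by fun_prop
  have := (hc.tendsto s).mono_left (nhdsWithin_le_nhds (s := Icc (0 : ℝ) 1))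
  simpa using this

omit [InnerProductSpace ℝ V] in
theorem HolderHalf.exists_bound {f : ℝ → V} (h : HolderHalf f) :
    ∃ B : ℝ, 0 ≤ B ∧ ∀ t ∈ Icc (0 : ℝ) 1, ‖f t‖ ≤ B := by
  obtain ⟨B, hB⟩ := isCompact_Icc.exists_bound_of_continuousOn h.continuousOn
  exact ⟨B, (norm_nonneg _).trans (hB 0 (left_mem_Icc.mpr zero_le_one)), hB⟩

omit [InnerProductSpace ℝ V] in
theorem HolderHalf.add {f f' : ℝ → V} (h : HolderHalf f) (h' : HolderHalf f') :
    HolderHalf fun t => f t + f' t := by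
  obtain ⟨C, hC, hf⟩ := h
  obtain ⟨C', hC', hf'⟩ := h'
  refine ⟨C + C', add_nonneg hC hC', fun s hs t ht => ?_⟩
  rw [add_sub_add_comm, add_mul]
  exact (norm_add_le _ _).trans (add_le_add (hf s hs t ht) (hf' s hs t ht))

omit [InnerProductSpace ℝ V] in
theorem HolderHalf.sub {f f' : ℝ → V} (h : HolderHalf f) (h' : HolderHalf f') :
    HolderHalf fun t => f t - f' t := by
  obtain ⟨C, hC, hf⟩ := h
  obtain ⟨C', hC', hf'⟩ := h'
  refine ⟨C + C', add_nonneg hC hC', fun s hs t ht => ?_⟩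
  rw [sub_sub_sub_comm, add_mul]
  exact (norm_sub_le _ _).trans (add_le_add (hf s hs t ht) (hf' s hs t ht))

theorem HolderHalf.sum_smul_const {κ : Type*} {e : κ → ℝ → ℝ} (he : ∀ k, HolderHalf (e k))
    (s : Finset κ) (d : κ → V) : HolderHalf fun t => ∑ k ∈ s, e k t • d k := by
  choose C hC h using he
  refine ⟨∑ k ∈ s, C k * ‖d k‖, Finset.sum_nonneg fun k _ => mul_nonneg (hC k) (norm_nonneg _),
    fun r hr t ht => ?_⟩
  rw [← Finset.sum_sub_distrib, Finset.sum_mul]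
  refine (norm_sum_le _ _).trans (Finset.sum_le_sum fun k _ => ?_)
  rw [← sub_smul, norm_smul, mul_right_comm]
  exact mul_le_mul_of_nonneg_right (h k r hr t ht) (norm_nonneg _)

/-- The Cauchy–Schwarz inequality on a subinterval. -/
theorem norm_intervalIntegral_le_sqrt {w : ℝ → V} (hw : MemL2 w) (s t : ℝ) :
    ‖∫ x in s..t, w x ∂unitMeasure‖ ≤ √(∫ x, ‖w x‖ ^ 2 ∂unitMeasure) * √|t - s| := by
  have hind : MemLp (indicator (uIoc s t) fun _ => (1 : ℝ)) 2 unitMeasure :=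
    (memLp_const 1).indicator measurableSet_uIoc
  have h1 := integral_mul_le_sqrt_mul_sqrt (f := fun x => ‖w x‖)
    (h := indicator (uIoc s t) fun _ => (1 : ℝ)) (fun _ => norm_nonneg _)
    (fun x => indicator_nonneg (fun _ _ => zero_le_one) x) (MemLp.norm hw) hind
  have h2 : ∫ x, ‖w x‖ * indicator (uIoc s t) (fun _ => (1 : ℝ)) x ∂unitMeasure =
      ∫ x in uIoc s t, ‖w x‖ ∂unitMeasure := by
    rw [← integral_indicator measurableSet_uIoc]
    congr 1
    funext x
    by_cases hx : x ∈ uIoc s t <;> simp [hx]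
  have h3 : ∫ x, indicator (uIoc s t) (fun _ => (1 : ℝ)) x ^ 2 ∂unitMeasure ≤ |t - s| := by
    have e : (fun x => indicator (uIoc s t) (fun _ => (1 : ℝ)) x ^ 2) =
        indicator (uIoc s t) fun _ => (1 : ℝ) := by
      funext x
      by_cases hx : x ∈ uIoc s t <;> simp [hx]
    rw [e, integral_indicator measurableSet_uIoc, setIntegral_const, smul_eq_mul, mul_one]
    refine ENNReal.toReal_le_of_le_ofReal (abs_nonneg _) ?_
    refine (Measure.restrict_apply_le _ _).trans_eq ?_
    rw [Real.volume_uIoc]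
  rw [h2] at h1
  exact intervalIntegral.norm_integral_le_integral_norm_uIoc.trans
    (h1.trans (mul_le_mul_of_nonneg_left (Real.sqrt_le_sqrt h3) (Real.sqrt_nonneg _)))

theorem HolderHalf.vel (b : V) {w : ℝ → V} (hw : MemL2 w) : HolderHalf (vel b w) :=
  ⟨_, Real.sqrt_nonneg _, fun s _ t _ => by
    rw [vel_sub_vel b hw.integrable]
    exact norm_intervalIntegral_le_sqrt hw s t⟩

end Holder

section Moments

variable {V : Type*} [NormedAddCommGroup V] [InnerProductSpace ℝ V] [CompleteSpace V]

/-- The weight with which the second derivative enters the position at time `τ`. For `s` and `τ` in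
`[0,1]` its value is `max (τ - s) 0`. -/
def positionWeight (τ s : ℝ) : ℝ :=
  ∫ x in s..1, indicator (Ioc 0 τ) (fun _ => (1 : ℝ)) x ∂unitMeasure

theorem memL2_indicator_one (τ : ℝ) : MemL2 (indicator (Ioc 0 τ) fun _ => (1 : ℝ)) :=
  (memLp_const 1).indicator measurableSet_Ioc

theorem positionWeight_eq (τ s : ℝ) : positionWeight τ s =
    (∫ x in (0 : ℝ)..1, indicator (Ioc 0 τ) (fun _ => (1 : ℝ)) x ∂unitMeasure) -
      vel 0 (indicator (Ioc 0 τ) fun _ => (1 : ℝ)) s := by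
  have hi := (memL2_indicator_one τ).integrable
  rw [positionWeight, vel, zero_add,
    intervalIntegral.integral_interval_sub_left hi.intervalIntegrable hi.intervalIntegrable]

theorem holderHalf_positionWeight (τ : ℝ) : HolderHalf (positionWeight τ) := by
  have h := HolderHalf.vel (0 : ℝ) (memL2_indicator_one τ)
  obtain ⟨C, hC, hf⟩ := h
  refine ⟨C, hC, fun s hs t ht => ?_⟩
  rw [positionWeight_eq, positionWeight_eq, sub_sub_sub_cancel_left, norm_sub_rev]
  exact hf s hs t ht

theorem continuous_positionWeight (τ : ℝ) : Continuous (positionWeight τ) := by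
  have : positionWeight τ = fun s => _ := funext (positionWeight_eq τ)
  rw [this]
  exact continuous_const.sub (continuous_vel (memL2_indicator_one τ).integrable)

theorem pos_zero_zero_eq_moment {w : ℝ → V} (hw : MemL2 w) {τ : ℝ} (hτ : τ ∈ Icc (0 : ℝ) 1) :
    pos 0 0 w τ = ∫ s, positionWeight τ s • w s ∂unitMeasure := by
  have h := integral_bilin_primitive (ContinuousLinearMap.lsmul ℝ ℝ : ℝ →L[ℝ] V →L[ℝ] V)
    (memL2_indicator_one τ).integrable hw.integrable
  simp only [ContinuousLinearMap.lsmul_apply] at h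
  simp only [positionWeight]
  rw [← h, pos_eq_vel _ _ hτ, vel, zero_add, intervalIntegral.integral_of_le hτ.1,
    ← integral_indicator measurableSet_Ioc]
  refine integral_congr_ae (Eventually.of_forall fun t => ?_)
  by_cases ht : t ∈ Ioc 0 τ <;> simp [ht, vel]

/-- If a field `G` satisfies, up to a multiple of the `L²` norm of the first derivative, the weak
equation `G'' = 0` away from finitely many nodes, then it is Hölder continuous. The test fields are
the second derivatives `w` of curves that vanish with their velocities at both ends of `[0,1]` and
vanish at the nodes. -/
theorem exists_holderHalf_of_weak_bound (S : Finset ℝ) (hS : ∀ τ ∈ S, τ ∈ Icc (0 : ℝ) 1)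
    {G : ℝ → V} (hG : MemL2 G) {K : ℝ}
    (hK : ∀ w : ℝ → V, MemL2 w → vel 0 w 1 = 0 → (∀ τ ∈ S, pos 0 0 w τ = 0) →
      |∫ t, inner ℝ (G t) (w t) ∂unitMeasure| ≤ K * √(∫ t, ‖vel 0 w t‖ ^ 2 ∂unitMeasure)) :
    ∃ G' : ℝ → V, HolderHalf G' ∧ G =ᵐ[unitMeasure] G' := by
  have hv2 : ∀ U : Lp V 2 unitMeasure, MemLp (vel 0 U) 2 unitMeasure := fun U =>
    memL2_of_continuous (continuous_vel (memL2_Lp U).integrable)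
  have hadd : ∀ U U' : Lp V 2 unitMeasure, ∀ t,
      vel 0 (U + U' : Lp V 2 unitMeasure) t = vel 0 U t + vel 0 U' t := fun U U' t => by
    rw [vel_congr (Lp.coeFn_add U U')]
    have := vel_add (0 : V) 0 (memL2_Lp U).integrable (memL2_Lp U').integrable t
    rwa [add_zero] at this
  have hsmul : ∀ (r : ℝ) (U : Lp V 2 unitMeasure), ∀ t,
      vel 0 (r • U : Lp V 2 unitMeasure) t = r • vel 0 U t := fun r U t => by
    rw [vel_congr (Lp.coeFn_smul r U)]
    have := vel_smul r (0 : V) U t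
    rwa [smul_zero] at this
  have hpadd : ∀ U U' : Lp V 2 unitMeasure, ∀ t,
      pos 0 0 (U + U' : Lp V 2 unitMeasure) t = pos 0 0 U t + pos 0 0 U' t := fun U U' t => by
    rw [pos_congr (Lp.coeFn_add U U')]
    have := pos_add (0 : V) 0 0 0 (memL2_Lp U).integrable (memL2_Lp U').integrable t
    rwa [add_zero] at this
  have hpsmul : ∀ (r : ℝ) (U : Lp V 2 unitMeasure), ∀ t,
      pos 0 0 (r • U : Lp V 2 unitMeasure) t = r • pos 0 0 U t := fun r U t => by
    rw [pos_congr (Lp.coeFn_smul r U)]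
    have := pos_smul r (0 : V) 0 U t
    rwa [smul_zero] at this
  -- the operator that maps second derivatives to first derivatives
  let T : Lp V 2 unitMeasure →ₗ[ℝ] Lp V 2 unitMeasure :=
    { toFun := fun U => MemLp.toLp (vel 0 U) (hv2 U)
      map_add' := fun U U' => by
        rw [← MemLp.toLp_add]
        exact MemLp.toLp_congr _ _ (Eventually.of_forall (hadd U U'))
      map_smul' := fun r U => by
        rw [RingHom.id_apply, ← MemLp.toLp_const_smul]
        exact MemLp.toLp_congr _ _ (Eventually.of_forall (hsmul r U)) }
  let N : Submodule ℝ (Lp V 2 unitMeasure) :=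
    { carrier := {U | vel 0 U 1 = 0 ∧ ∀ τ ∈ S, pos 0 0 U τ = 0}
      zero_mem' := by
        have h1 : ∀ t, vel 0 (0 : Lp V 2 unitMeasure) t = 0 := fun t => by
          simpa using hsmul 0 0 t
        have h2 : ∀ t, pos 0 0 (0 : Lp V 2 unitMeasure) t = 0 := fun t => by
          simpa using hpsmul 0 0 t
        exact ⟨h1 1, fun τ _ => h2 τ⟩
      add_mem' := fun {U U'} hU hU' => ⟨by rw [hadd, hU.1, hU'.1, add_zero],
        fun τ hτ => by rw [hpadd, hU.2 τ hτ, hU'.2 τ hτ, add_zero]⟩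
      smul_mem' := fun r U hU => ⟨by rw [hsmul, hU.1, smul_zero],
        fun τ hτ => by rw [hpsmul, hU.2 τ hτ, smul_zero]⟩ }
  have hG' : MemLp G 2 unitMeasure := hG
  have hGU : ∀ U : Lp V 2 unitMeasure, inner ℝ (MemLp.toLp G hG') U =
      ∫ t, inner ℝ (G t) (U t) ∂unitMeasure := fun U => by
    rw [L2.inner_def]
    refine integral_congr_ae ?_
    filter_upwards [MemLp.coeFn_toLp hG'] with t ht
    rw [ht]
  obtain ⟨h, hh⟩ := exists_inner_eq_inner_comp T N (MemLp.toLp G hG') (K := K) (by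
    intro U hU
    rw [hGU]
    refine (hK U (memL2_Lp U) hU.1 hU.2).trans_eq ?_
    congr 1
    rw [← Real.sqrt_sq (norm_nonneg (T U)), ← integral_norm_sq_Lp]
    congr 1
    refine integral_congr_ae ?_
    filter_upwards [MemLp.coeFn_toLp (hv2 U)] with t ht
    simp only [T, LinearMap.coe_mk, AddHom.coe_mk, ht])
  have hhi := (memL2_Lp h).integrable
  set P : ℝ → V := fun s => ∫ t in s..1, h t ∂unitMeasure with hP
  have hPeq : ∀ s, P s = (∫ x in (0 : ℝ)..1, h x ∂unitMeasure) - vel 0 h s := fun s => by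
    rw [hP, vel, zero_add, intervalIntegral.integral_interval_sub_left hhi.intervalIntegrable
      hhi.intervalIntegrable]
  have hPc : Continuous P := by
    rw [funext hPeq]
    exact continuous_const.sub (continuous_vel hhi)
  have hPH : HolderHalf P := by
    obtain ⟨C, hC, hf⟩ := HolderHalf.vel (0 : V) (memL2_Lp h)
    refine ⟨C, hC, fun s hs t ht => ?_⟩
    rw [hPeq, hPeq, sub_sub_sub_cancel_left, norm_sub_rev]
    exact hf s hs t ht
  have hP2 := memL2_of_continuous hPc
  -- integration by parts turns the pairing with `h` into a pairing with its primitive `P`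
  have horth : ∀ U ∈ N, ∫ t, inner ℝ (G t - P t) (U t) ∂unitMeasure = 0 := by
    intro U hU
    have h1 := hh U hU
    rw [hGU, L2.inner_def] at h1
    have h2 : ∫ t, inner ℝ (h t) (T U t) ∂unitMeasure =
        ∫ t, inner ℝ (h t) (∫ s in (0 : ℝ)..t, U s ∂unitMeasure) ∂unitMeasure := by
      refine integral_congr_ae ?_
      filter_upwards [MemLp.coeFn_toLp (hv2 U)] with t ht
      simp only [T, LinearMap.coe_mk, AddHom.coe_mk, ht, vel, zero_add]
    have h3 : ∫ t, inner ℝ (h t) (∫ s in (0 : ℝ)..t, U s ∂unitMeasure) ∂unitMeasure =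
        ∫ s, inner ℝ (P s) (U s) ∂unitMeasure :=
      integral_bilin_primitive (innerSL ℝ : V →L[ℝ] V →L[ℝ] ℝ) hhi (memL2_Lp U).integrable
    simp only [inner_sub_left]
    rw [integral_sub (hG.integrable_inner (memL2_Lp U)) (hP2.integrable_inner (memL2_Lp U)),
      h1, h2, h3, sub_self]
  -- the moment against `e none` is the final velocity, that against `e (some τ)` the position at `τ`
  let e : Option ℝ → ℝ → ℝ := fun k => k.elim (fun _ => 1) positionWeight
  have hec : ∀ k, Continuous (e k)
    | none => continuous_const
    | some τ => continuous_positionWeight τ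
  have heH : ∀ k, HolderHalf (e k)
    | none => ⟨0, le_rfl, fun s _ t _ => by simp [e]⟩
    | some τ => holderHalf_positionWeight τ
  obtain ⟨d, hd⟩ := exists_ae_eq_sum_of_moments e (fun k => memL2_of_continuous (hec k))
    (Finset.insertNone S) (G := fun t => G t - P t) (MemLp.sub hG hP2) (by
      intro w hw hmom
      have hw' : MemLp w 2 unitMeasure := hw
      have hae := MemLp.coeFn_toLp hw'
      rw [← horth (MemLp.toLp w hw') ⟨?_, fun τ hτ => ?_⟩]
      · refine integral_congr_ae ?_
        filter_upwards [hae] with t ht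
        rw [ht]
      · rw [vel_congr hae, vel_one, zero_add]
        simpa [e] using hmom none (by simp)
      · rw [pos_congr hae, pos_zero_zero_eq_moment hw (hS τ hτ)]
        exact hmom (some τ) (by simpa using hτ))
  refine ⟨fun t => (∑ k ∈ Finset.insertNone S, e k t • d k) + P t,
    (HolderHalf.sum_smul_const heH _ d).add hPH, ?_⟩
  filter_upwards [hd] with t ht
  rw [← ht, sub_add_cancel]

end Moments

/-! ### The first variation of the energy -/

section Variation

variable {V Y : Type*} [NormedAddCommGroup V] [InnerProductSpace ℝ V]
  [NormedAddCommGroup Y] [NormedSpace ℝ Y] {ι : V →L[ℝ] Y} {g : V → V →L[ℝ] V →L[ℝ] ℝ} {c M : ℝ}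

/-- The `L²` norm of a function on `(0,1)`. -/
def normL2 (w : ℝ → V) : ℝ := √(∫ t, ‖w t‖ ^ 2 ∂unitMeasure)

omit [InnerProductSpace ℝ V] in
theorem normL2_nonneg (w : ℝ → V) : 0 ≤ normL2 w := Real.sqrt_nonneg _

omit [InnerProductSpace ℝ V] in
theorem normL2_sq (w : ℝ → V) : normL2 w ^ 2 = ∫ t, ‖w t‖ ^ 2 ∂unitMeasure :=
  Real.sq_sqrt (integral_nonneg fun _ => sq_nonneg _)

omit [InnerProductSpace ℝ V] in
theorem integral_norm_mul_norm_le {u d : ℝ → V} (hu : MemL2 u) (hd : MemL2 d) :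
    ∫ t, ‖u t‖ * ‖d t‖ ∂unitMeasure ≤ normL2 u * normL2 d :=
  integral_mul_le_sqrt_mul_sqrt (fun _ => norm_nonneg _) (fun _ => norm_nonneg _)
    (MemLp.norm hu) (MemLp.norm hd)

namespace MetricBounds

theorem abs_integral_le (h : MetricBounds ι g c M) {y u d : ℝ → V} (hy : Continuous y)
    (hu : MemL2 u) (hd : MemL2 d) :
    |∫ t, g (y t) (u t) (d t) ∂unitMeasure| ≤ M * (normL2 u * normL2 d) := by
  have hi : Integrable (fun t => ‖u t‖ * ‖d t‖) unitMeasure :=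
    MemLp.integrable_mul (MemLp.norm hu) (MemLp.norm hd)
  calc |∫ t, g (y t) (u t) (d t) ∂unitMeasure|
      ≤ ∫ t, |g (y t) (u t) (d t)| ∂unitMeasure := abs_integral_le_integral_abs
    _ ≤ ∫ t, M * (‖u t‖ * ‖d t‖) ∂unitMeasure :=
        integral_mono (h.integrable hy hu hd).abs (hi.const_mul M)
          fun t => (h.bound _ _ _).trans_eq (mul_assoc _ _ _)
    _ ≤ M * (normL2 u * normL2 d) := by
        rw [integral_const_mul]
        exact mul_le_mul_of_nonneg_left (integral_norm_mul_norm_le hu hd) h.M_nonneg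

/-- An upper bound for the energy of a field after the base curve has moved by at most `q` and the
field has changed by `d`. The contribution linear in `d` is exact, the others are estimated. -/
theorem fieldEnergy_add_le (h : MetricBounds ι g c M) {y y' u d : ℝ → V} (hy : Continuous y)
    (hy' : Continuous y') (hu : MemL2 u) (hd : MemL2 d) {q : ℝ}
    (hq : ∀ t ∈ Icc (0 : ℝ) 1, ‖y' t - y t‖ ≤ q) :
    fieldEnergy g y' (fun t => u t + d t) ≤ fieldEnergy g y u +
      2 * (∫ t, g (y t) (u t) (d t) ∂unitMeasure) + M * ‖ι‖ * q * normL2 u ^ 2 +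
      2 * (M * ‖ι‖ * q * (normL2 u * normL2 d)) + M * normL2 d ^ 2 := by
  have hM := h.M_nonneg
  have hq0 : 0 ≤ q := (norm_nonneg _).trans (hq 0 (left_mem_Icc.mpr zero_le_one))
  set L := M * ‖ι‖ * q with hL
  have hL0 : 0 ≤ L := by positivity
  have i1 := h.integrable hy hu hu
  have i2 := h.integrable hy hu hd
  have i3 := hu.integrable_norm_sq
  have i4 : Integrable (fun t => ‖u t‖ * ‖d t‖) unitMeasure :=
    MemLp.integrable_mul (MemLp.norm hu) (MemLp.norm hd)
  have i5 := hd.integrable_norm_sq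
  have j1 : Integrable (fun t => g (y t) (u t) (u t) + 2 * g (y t) (u t) (d t)) unitMeasure :=
    i1.add (i2.const_mul 2)
  have j2 : Integrable (fun t => g (y t) (u t) (u t) + 2 * g (y t) (u t) (d t) +
      L * ‖u t‖ ^ 2) unitMeasure := j1.add (i3.const_mul L)
  have j3 : Integrable (fun t => g (y t) (u t) (u t) + 2 * g (y t) (u t) (d t) +
      L * ‖u t‖ ^ 2 + 2 * L * (‖u t‖ * ‖d t‖)) unitMeasure := j2.add (i4.const_mul (2 * L))
  have j4 : Integrable (fun t => g (y t) (u t) (u t) + 2 * g (y t) (u t) (d t) +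
      L * ‖u t‖ ^ 2 + 2 * L * (‖u t‖ * ‖d t‖) + M * ‖d t‖ ^ 2) unitMeasure :=
    j3.add (i5.const_mul M)
  have hud : MemL2 fun t => u t + d t := MemLp.add hu hd
  have hpt : ∀ᵐ t ∂unitMeasure, g (y' t) (u t + d t) (u t + d t) ≤
      g (y t) (u t) (u t) + 2 * g (y t) (u t) (d t) + L * ‖u t‖ ^ 2 +
        2 * L * (‖u t‖ * ‖d t‖) + M * ‖d t‖ ^ 2 := by
    filter_upwards [ae_unitMeasure_mem] with t ht
    have hqt := hq t (Ioo_subset_Icc_self ht)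
    have hl : ∀ v z, |g (y' t) v z - g (y t) v z| ≤ L * ‖v‖ * ‖z‖ := fun v z =>
      (h.lip_norm _ _ v z).trans (by rw [hL]; gcongr)
    have e1 := (abs_le.mp (hl (u t) (u t))).2
    have e2 := (abs_le.mp (hl (u t) (d t))).2
    have e3 := h.apply_self_le (y' t) (d t)
    have e4 := h.symm (y' t) (d t) (u t)
    simp only [map_add, add_apply]
    nlinarith
  have hint := integral_mono_ae (h.integrable hy' hud hud) j4 hpt
  rw [integral_add j3 (i5.const_mul M), integral_add j2 (i4.const_mul (2 * L)),
    integral_add j1 (i3.const_mul L), integral_add i1 (i2.const_mul 2), integral_const_mul,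
    integral_const_mul, integral_const_mul, integral_const_mul, ← normL2_sq, ← normL2_sq] at hint
  have hcs := mul_le_mul_of_nonneg_left (integral_norm_mul_norm_le hu hd) hL0
  rw [fieldEnergy, fieldEnergy]
  linarith

end MetricBounds

/-- If `2 ε I + |ε| A + ε² B` is nonnegative for all small `ε` of either sign, then `|I| ≤ A / 2`.
The number `R` says how small `ε` has to be. -/
theorem abs_le_of_forall_small {I A B R : ℝ}
    (h : ∀ ε : ℝ, |ε| * R ≤ 1 → 0 ≤ 2 * ε * I + |ε| * A + ε ^ 2 * B) : |I| ≤ A / 2 := by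
  have key : ∀ᶠ ε : ℝ in 𝓝[>] 0, 2 * |I| ≤ A + ε * B := by
    have h1 : ∀ᶠ ε : ℝ in 𝓝[>] 0, ε * R < 1 := by
      have hc : Continuous fun ε : ℝ => ε * R := by fun_prop
      have : ∀ᶠ ε : ℝ in 𝓝 0, ε * R < 1 := hc.continuousAt.eventually_lt continuousAt_const (by simp)
      exact this.filter_mono nhdsWithin_le_nhds
    filter_upwards [h1, self_mem_nhdsWithin] with ε hε hpos
    have hε0 : (0 : ℝ) < ε := hpos
    have e1 := h ε (by rw [abs_of_pos hε0]; exact hε.le)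
    have e2 := h (-ε) (by rw [abs_neg, abs_of_pos hε0]; exact hε.le)
    rw [abs_of_pos hε0] at e1
    rw [abs_neg, abs_of_pos hε0] at e2
    have e3 : ε * (2 * |I|) ≤ ε * (A + ε * B) := by
      rcases abs_cases I with ⟨hI, _⟩ | ⟨hI, _⟩ <;> rw [hI] <;> nlinarith
    exact le_of_mul_le_mul_left e3 hε0
  have hlim : Tendsto (fun ε : ℝ => A + ε * B) (𝓝[>] 0) (𝓝 A) := by
    have hc : Continuous fun ε : ℝ => A + ε * B := by fun_prop
    have := (hc.tendsto 0).mono_left (nhdsWithin_le_nhds (s := Ioi (0 : ℝ)))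
    simpa using this
  have := ge_of_tendsto hlim key
  linarith

variable [CompleteSpace V]

/-- The regularized spline energy in terms of the initial data and the acceleration. -/
def dataEnergy (g : V → V →L[ℝ] V →L[ℝ] ℝ) (σ : ℝ) (a b : V) (w : ℝ → V) : ℝ :=
  fieldEnergy g (pos a b w) (cov g a b w) + σ * fieldEnergy g (pos a b w) (vel b w)

/-- The weak form of the optimality condition. Varying the acceleration by `ε • η` changes the
energy by `2 ε ∫ g(cov, η)`, plus first order terms in which only the variation of position and
velocity enter, plus terms of second order in `ε`. At a minimizer, the leading term is
therefore controlled by the `L²` norm of the variation of the velocity. -/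
theorem MetricBounds.exists_weak_bound (h : MetricBounds ι g c M) {σ : ℝ} (hσ : 0 ≤ σ)
    (a b : V) {w : ℝ → V} (hw : MemL2 w) :
    ∃ K : ℝ, ∀ η : ℝ → V, MemL2 η →
      (∀ ε : ℝ, dataEnergy g σ a b w ≤ dataEnergy g σ a b fun t => w t + ε • η t) →
      |∫ t, g (pos a b w t) (cov g a b w t) (η t) ∂unitMeasure| ≤
        K * √(∫ t, ‖vel 0 η t‖ ^ 2 ∂unitMeasure) := by
  have hM := h.M_nonneg
  set Rv := ‖b‖ + ∫ x, ‖w x‖ ∂unitMeasure with hRv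
  obtain ⟨C₀, hC₀, hlip⟩ := h.exists_christoffel_lip (Rv + 1)
  set C := C₀ * ‖ι‖ with hC
  have hC0 : 0 ≤ C := by positivity
  have hwi := hw.integrable
  have hpc : Continuous (pos a b w) := continuous_pos hwi
  have hv2 : MemL2 (vel b w) := memL2_of_continuous (continuous_vel hwi)
  have hu2 := h.memL2_cov a b hw
  set U := normL2 (cov g a b w) with hU
  set W := normL2 (vel b w) with hW
  have hU0 : 0 ≤ U := normL2_nonneg _
  have hW0 : 0 ≤ W := normL2_nonneg _
  set K := 4 * M * C * U + M * ‖ι‖ * U ^ 2 + σ * (2 * M * W + M * ‖ι‖ * W ^ 2) with hK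
  refine ⟨K / 2, fun η hη hmin => ?_⟩
  change _ ≤ K / 2 * normL2 (vel 0 η)
  have hηi := hη.integrable
  have hψc : Continuous (vel 0 η) := continuous_vel hηi
  have hψ2 : MemL2 (vel 0 η) := memL2_of_continuous hψc
  set N := normL2 (vel 0 η) with hN
  have hN0 : 0 ≤ N := normL2_nonneg _
  set Rψ := ‖(0 : V)‖ + ∫ x, ‖η x‖ ∂unitMeasure with hRψ
  have hψR : ∀ t, ‖vel 0 η t‖ ≤ Rψ := norm_vel_le 0 hηi
  have hvR : ∀ t, ‖vel b w t‖ ≤ Rv := norm_vel_le b hwi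
  have hφN : ∀ t ∈ Icc (0 : ℝ) 1, ‖pos 0 0 η t‖ ≤ N := by
    intro t ht
    rw [pos_eq_vel _ _ ht, vel, zero_add]
    refine (norm_intervalIntegral_le_sqrt hψ2 0 t).trans ?_
    refine mul_le_of_le_one_right hN0 (Real.sqrt_le_one.mpr ?_)
    rw [sub_zero, abs_of_nonneg ht.1]
    exact ht.2
  set I := ∫ t, g (pos a b w t) (cov g a b w t) (η t) ∂unitMeasure with hI
  set Q := √(2 * normL2 η ^ 2 + 8 * C ^ 2 * N ^ 2) with hQ
  have hQ0 : 0 ≤ Q := Real.sqrt_nonneg _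
  have hQ2 : Q ^ 2 = 2 * normL2 η ^ 2 + 8 * C ^ 2 * N ^ 2 := Real.sq_sqrt (by positivity)
  set B := 2 * (M * ‖ι‖ * N * (U * Q)) + M * Q ^ 2 +
    σ * (2 * (M * ‖ι‖ * N * (W * N)) + M * N ^ 2) with hB
  have hfinal : |I| ≤ (N * K) / 2 := by
    refine abs_le_of_forall_small (B := B) (R := Rψ) fun ε hε => ?_
    set wε : ℝ → V := fun t => w t + ε • η t with hwε
    have hwε2 : MemL2 wε := MemLp.add hw (MemLp.const_smul hη ε)
    have hpos : ∀ t, pos a b wε t = pos a b w t + ε • pos 0 0 η t := fun t => by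
      have h1 := pos_add a (ε • 0) b (ε • 0) hwi (hηi.smul ε) t
      have h2 := pos_smul ε 0 0 η t
      simp only [smul_zero, add_zero] at h1 h2
      rw [← h2]
      exact h1
    have hvel : ∀ t, vel b wε t = vel b w t + ε • vel 0 η t := fun t => by
      have h1 := vel_add b (ε • 0) hwi (hηi.smul ε) t
      have h2 := vel_smul ε 0 η t
      simp only [smul_zero, add_zero] at h1 h2
      rw [← h2]
      exact h1
    have hpcε : Continuous (pos a b wε) := continuous_pos hwε2.integrable
    have hq : ∀ t ∈ Icc (0 : ℝ) 1, ‖pos a b wε t - pos a b w t‖ ≤ |ε| * N := by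
      intro t ht
      rw [hpos, add_sub_cancel_left, norm_smul, Real.norm_eq_abs]
      exact mul_le_mul_of_nonneg_left (hφN t ht) (abs_nonneg ε)
    -- the variation of the Christoffel term
    set Δ : ℝ → V := fun t => christoffel g (pos a b wε t) (vel b wε t) (vel b wε t) -
      christoffel g (pos a b w t) (vel b w t) (vel b w t) with hΔ
    have hΔc : Continuous Δ := (h.continuous_christoffel_curve a b hwε2.integrable).sub
      (h.continuous_christoffel_curve a b hwi)
    have hΔ2 : MemL2 Δ := memL2_of_continuous hΔc
    have hΔpt : ∀ t ∈ Icc (0 : ℝ) 1, ‖Δ t‖ ≤ |ε| * C * (N + ‖vel 0 η t‖) := by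
      intro t ht
      have e1 : ‖vel b wε t‖ ≤ Rv + 1 := by
        rw [hvel]
        refine (norm_add_le _ _).trans (add_le_add (hvR t) ?_)
        rw [norm_smul, Real.norm_eq_abs]
        exact (mul_le_mul_of_nonneg_left (hψR t) (abs_nonneg ε)).trans hε
      refine (hlip _ _ _ _ e1 ((hvR t).trans (by linarith))).trans ?_
      rw [← map_sub, ← map_sub]
      have e2 : ‖ι (pos a b wε t - pos a b w t)‖ ≤ ‖ι‖ * (|ε| * N) :=
        ι.le_opNorm_of_le (hq t ht)
      have e3 : ‖ι (vel b wε t - vel b w t)‖ ≤ ‖ι‖ * (|ε| * ‖vel 0 η t‖) := by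
        refine ι.le_opNorm_of_le ?_
        rw [hvel, add_sub_cancel_left, norm_smul, Real.norm_eq_abs]
      calc C₀ * (‖ι (pos a b wε t - pos a b w t)‖ + ‖ι (vel b wε t - vel b w t)‖)
          ≤ C₀ * (‖ι‖ * (|ε| * N) + ‖ι‖ * (|ε| * ‖vel 0 η t‖)) := by gcongr
        _ = |ε| * C * (N + ‖vel 0 η t‖) := by rw [hC]; ring
    have hΔN : normL2 Δ ^ 2 ≤ 4 * ε ^ 2 * C ^ 2 * N ^ 2 := by
      rw [normL2_sq]
      have j := hψ2.integrable_norm_sq.const_mul (2 * ε ^ 2 * C ^ 2)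
      calc ∫ t, ‖Δ t‖ ^ 2 ∂unitMeasure
          ≤ ∫ t, (2 * ε ^ 2 * C ^ 2 * N ^ 2 + 2 * ε ^ 2 * C ^ 2 * ‖vel 0 η t‖ ^ 2)
              ∂unitMeasure := by
            refine integral_mono_ae hΔ2.integrable_norm_sq ((integrable_const _).add j) ?_
            filter_upwards [ae_unitMeasure_mem] with t ht
            have e1 := pow_le_pow_left₀ (norm_nonneg _) (hΔpt t (Ioo_subset_Icc_self ht)) 2
            refine e1.trans ?_
            rw [mul_pow, mul_pow, sq_abs]
            have e2 : 0 ≤ ε ^ 2 * C ^ 2 := by positivity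
            nlinarith [sq_nonneg (N - ‖vel 0 η t‖)]
        _ = 4 * ε ^ 2 * C ^ 2 * N ^ 2 := by
            rw [integral_add (integrable_const _) j, integral_const, integral_const_mul,
              ← normL2_sq, ← hN]
            simp only [measureReal_restrict_apply, MeasurableSet.univ, univ_inter,
              Real.volume_real_Ioo_of_le zero_le_one, sub_zero, one_smul]
            ring
    have hΔN' : normL2 Δ ≤ 2 * |ε| * C * N := by
      refine le_of_sq_le_sq ?_ (by positivity)
      calc normL2 Δ ^ 2 ≤ 4 * ε ^ 2 * C ^ 2 * N ^ 2 := hΔN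
        _ = (2 * |ε| * C * N) ^ 2 := by rw [← sq_abs ε]; ring
    set d : ℝ → V := fun t => ε • η t + Δ t with hd
    have hεη : MemL2 fun t => ε • η t := MemLp.const_smul hη ε
    have hd2 : MemL2 d := MemLp.add hεη hΔ2
    have hcov : cov g a b wε = fun t => cov g a b w t + d t := by
      funext t
      simp only [cov, hd, hΔ, hwε]
      abel
    have hdQ : normL2 d ≤ |ε| * Q := by
      refine le_of_sq_le_sq ?_ (by positivity)
      rw [mul_pow, hQ2, sq_abs, normL2_sq]
      have j1 := hη.integrable_norm_sq.const_mul (2 * ε ^ 2)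
      have j2 := hΔ2.integrable_norm_sq.const_mul 2
      calc ∫ t, ‖d t‖ ^ 2 ∂unitMeasure
          ≤ ∫ t, (2 * ε ^ 2 * ‖η t‖ ^ 2 + 2 * ‖Δ t‖ ^ 2) ∂unitMeasure := by
            refine integral_mono hd2.integrable_norm_sq (j1.add j2) fun t => ?_
            have e1 : ‖d t‖ ≤ |ε| * ‖η t‖ + ‖Δ t‖ := by
              refine (norm_add_le _ _).trans_eq ?_
              rw [norm_smul, Real.norm_eq_abs]
            have e2 := pow_le_pow_left₀ (norm_nonneg _) e1 2
            simp only
            nlinarith [sq_nonneg (|ε| * ‖η t‖ - ‖Δ t‖), sq_abs ε]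
        _ = 2 * ε ^ 2 * normL2 η ^ 2 + 2 * normL2 Δ ^ 2 := by
            rw [integral_add j1 j2, integral_const_mul, integral_const_mul, normL2_sq, normL2_sq]
        _ ≤ ε ^ 2 * (2 * normL2 η ^ 2 + 8 * C ^ 2 * N ^ 2) := by linarith
    -- the change of the two energies
    have hF := h.fieldEnergy_add_le hpc hpcε hu2 hd2 hq
    rw [← hcov] at hF
    have hgd : ∫ t, g (pos a b w t) (cov g a b w t) (d t) ∂unitMeasure =
        ε * I + ∫ t, g (pos a b w t) (cov g a b w t) (Δ t) ∂unitMeasure := by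
      simp only [hd, map_add, map_smul, smul_eq_mul]
      rw [integral_add ((h.integrable hpc hu2 hη).const_mul ε) (h.integrable hpc hu2 hΔ2),
        integral_const_mul]
    have hgΔ := (abs_le.mp (h.abs_integral_le hpc hu2 hΔ2)).2
    have hεψ : MemL2 fun t => ε • vel 0 η t := MemLp.const_smul hψ2 ε
    have hE := h.fieldEnergy_add_le hpc hpcε hv2 hεψ hq
    have hvel' : vel b wε = fun t => vel b w t + ε • vel 0 η t := funext hvel
    rw [← hvel'] at hE
    have hεψN : normL2 (fun t => ε • vel 0 η t) = |ε| * N := by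
      rw [hN, normL2, normL2, ← Real.sqrt_sq_eq_abs, ← Real.sqrt_mul (sq_nonneg ε),
        ← integral_const_mul]
      congr 2
      funext t
      rw [norm_smul, mul_pow, Real.norm_eq_abs, sq_abs]
    rw [hεψN, mul_pow, sq_abs] at hE
    have hgψ := (abs_le.mp (h.abs_integral_le hpc hv2 hεψ)).2
    rw [hεψN] at hgψ
    have hmin' := hmin ε
    rw [dataEnergy, dataEnergy] at hmin'
    -- collect the terms of first and second order in `ε`
    have f1 : M * (U * normL2 Δ) ≤ M * (U * (2 * |ε| * C * N)) := by gcongr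
    have f2 : M * ‖ι‖ * (|ε| * N) * (U * normL2 d) ≤ M * ‖ι‖ * (|ε| * N) * (U * (|ε| * Q)) := by
      gcongr
    have f3 : M * normL2 d ^ 2 ≤ M * (|ε| * Q) ^ 2 := by
      gcongr
      exact normL2_nonneg _
    have habs : |ε| * |ε| = ε ^ 2 := by rw [← sq, sq_abs]
    have hFtot : fieldEnergy g (pos a b wε) (cov g a b wε) ≤
        fieldEnergy g (pos a b w) (cov g a b w) + 2 * ε * I +
        |ε| * (N * (4 * M * C * U + M * ‖ι‖ * U ^ 2)) +
        ε ^ 2 * (2 * (M * ‖ι‖ * N * (U * Q)) + M * Q ^ 2) := by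
      rw [hgd] at hF
      rw [mul_pow, sq_abs] at f3
      have f2' : M * ‖ι‖ * (|ε| * N) * (U * (|ε| * Q)) = ε ^ 2 * (M * ‖ι‖ * N * (U * Q)) := by
        rw [← habs]; ring
      rw [f2'] at f2
      linarith
    have hEtot : fieldEnergy g (pos a b wε) (vel b wε) ≤
        fieldEnergy g (pos a b w) (vel b w) +
        |ε| * (N * (2 * M * W + M * ‖ι‖ * W ^ 2)) +
        ε ^ 2 * (2 * (M * ‖ι‖ * N * (W * N)) + M * N ^ 2) := by
      have f4 : M * ‖ι‖ * (|ε| * N) * (W * (|ε| * N)) = ε ^ 2 * (M * ‖ι‖ * N * (W * N)) := by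
        rw [← habs]; ring
      rw [f4] at hE
      linarith
    have hEσ := mul_le_mul_of_nonneg_left hEtot hσ
    rw [hK, hB]
    linarith
  linarith

end Variation

/-! ### Regularity of minimizers -/

section Regularity

variable {V Y : Type*} [NormedAddCommGroup V] [InnerProductSpace ℝ V] [CompleteSpace V]
  [NormedAddCommGroup Y] [NormedSpace ℝ Y] {ι : V →L[ℝ] Y} {g : V → V →L[ℝ] V →L[ℝ] ℝ} {c M : ℝ}

omit [InnerProductSpace ℝ V] [CompleteSpace V] in
theorem HolderHalf.congr {f f' : ℝ → V} (h : HolderHalf f) (he : EqOn f' f (Icc 0 1)) :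
    HolderHalf f' := by
  obtain ⟨C, hC, hf⟩ := h
  refine ⟨C, hC, fun s hs t ht => ?_⟩
  rw [he hs, he ht]
  exact hf s hs t ht

omit [CompleteSpace V] in
theorem holderHalf_pos (a b : V) {w : ℝ → V} (hw : Integrable w unitMeasure) :
    HolderHalf (pos a b w) :=
  (HolderHalf.vel a (memL2_of_continuous (continuous_vel (b := b) hw))).congr
    fun _ ht => pos_eq_vel a b ht

theorem MetricBounds.holderHalf_christoffel (h : MetricBounds ι g c M) {y v : ℝ → V}
    (hy : HolderHalf y) (hv : HolderHalf v) :
    HolderHalf fun t => christoffel g (y t) (v t) (v t) := by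
  obtain ⟨R, -, hR⟩ := hv.exists_bound
  obtain ⟨C, hC, hlip⟩ := h.exists_christoffel_lip R
  obtain ⟨C₁, hC₁, h₁⟩ := hy
  obtain ⟨C₂, hC₂, h₂⟩ := hv
  refine ⟨C * (‖ι‖ * C₁ + ‖ι‖ * C₂), by positivity, fun s hs t ht => ?_⟩
  refine (hlip _ _ _ _ (hR t ht) (hR s hs)).trans ?_
  rw [← map_sub, ← map_sub, mul_assoc, add_mul, mul_assoc, mul_assoc]
  gcongr
  · exact ι.le_opNorm_of_le (h₁ s hs t ht)
  · exact ι.le_opNorm_of_le (h₂ s hs t ht)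

/-- Raising the index of a Hölder continuous covector field along a Hölder continuous curve. -/
theorem MetricBounds.exists_holderHalf_sharp (h : MetricBounds ι g c M) {y G : ℝ → V}
    (hy : HolderHalf y) (hG : HolderHalf G) :
    ∃ u : ℝ → V, HolderHalf u ∧ ∀ t z, g (y t) (u t) z = inner ℝ (G t) z := by
  have hM := h.M_nonneg
  have hc := h.c_pos
  have hco : ∀ t, IsCoercive (g (y t)) := fun t => ⟨c, hc, fun v => by
    have := h.coercive (y t) v
    rwa [pow_two, ← mul_assoc] at this⟩
  have hu : ∀ t z, g (y t) ((hco t).continuousLinearEquivOfBilin.symm (G t)) z =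
      inner ℝ (G t) z := fun t z => by
    rw [← IsCoercive.continuousLinearEquivOfBilin_apply (hco t),
      ContinuousLinearEquiv.apply_symm_apply]
  obtain ⟨B, hB0, hB⟩ := hG.exists_bound
  obtain ⟨C₁, hC₁, h₁⟩ := hy
  obtain ⟨C₂, hC₂, h₂⟩ := hG
  set u : ℝ → V := fun t => (hco t).continuousLinearEquivOfBilin.symm (G t) with hudef
  have huB : ∀ t ∈ Icc (0 : ℝ) 1, ‖u t‖ ≤ B / c := fun t ht =>
    h.norm_le_of_forall hB0 fun z => by
      rw [hu]
      exact (real_inner_le_norm _ _).trans (by gcongr; exact hB t ht)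
  refine ⟨u, ⟨(C₂ + M * ‖ι‖ * C₁ * (B / c)) / c, by positivity, fun s hs t ht => ?_⟩, hu⟩
  rw [div_mul_eq_mul_div]
  refine h.norm_le_of_forall (y := y t) (by positivity) fun z => ?_
  have e1 : g (y t) (u t - u s) z = inner ℝ (G t - G s) z -
      (g (y t) (u s) z - g (y s) (u s) z) := by
    rw [map_sub, sub_apply, hu, hu, inner_sub_left]
    ring
  have e2 : inner ℝ (G t - G s) z ≤ C₂ * √|t - s| * ‖z‖ :=
    (real_inner_le_norm _ _).trans (by gcongr; exact h₂ s hs t ht)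
  have e3 := (abs_le.mp (h.lip_norm (y t) (y s) (u s) z)).1
  have e4 : M * ‖ι‖ * ‖y t - y s‖ * ‖u s‖ * ‖z‖ ≤
      M * ‖ι‖ * (C₁ * √|t - s|) * (B / c) * ‖z‖ := by
    gcongr
    · exact h₁ s hs t ht
    · exact huB s hs
  rw [e1]
  calc inner ℝ (G t - G s) z - (g (y t) (u s) z - g (y s) (u s) z)
      ≤ C₂ * √|t - s| * ‖z‖ + M * ‖ι‖ * (C₁ * √|t - s|) * (B / c) * ‖z‖ := by linarith
    _ = (C₂ + M * ‖ι‖ * C₁ * (B / c)) * √|t - s| * ‖z‖ := by ring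

omit [CompleteSpace V] in
theorem MetricBounds.eq_of_forall_apply_eq (h : MetricBounds ι g c M) {y u u' : V}
    (he : ∀ z, g y u z = g y u' z) : u = u' := by
  have h1 : ‖u - u'‖ ≤ 0 / c := h.norm_le_of_forall le_rfl fun z => by
    rw [map_sub, sub_apply, he, sub_self, zero_mul]
  rw [zero_div] at h1
  exact sub_eq_zero.mp (norm_le_zero_iff.mp h1)

/-- Varying the acceleration of a competitor by a field whose double primitive vanishes at the nodes
and, together with its derivative, at the end points yields competitors. -/
theorem IsCompetitor.add_smul {n : ℕ} {t : Fin (n + 1) → ℝ} (ht : ∀ i, t i ∈ Icc (0 : ℝ) 1)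
    {p : Fin (n + 1) → V} {bc : BoundaryCondition V} {y : ℝ → V} (hy : IsCompetitor t p bc y)
    {a b : V} {w η : ℝ → V} (hw : MemL2 w) (hη : MemL2 η) (h : EqOn y (pos a b w) (Icc 0 1))
    (hv : vel 0 η 1 = 0) (hp : pos 0 0 η 1 = 0) (hpt : ∀ i, pos 0 0 η (t i) = 0) (ε : ℝ) :
    IsCompetitor t p bc (pos a b fun s => w s + ε • η s) := by
  have h0 : (0 : ℝ) ∈ Icc (0 : ℝ) 1 := left_mem_Icc.mpr zero_le_one
  have h1 : (1 : ℝ) ∈ Icc (0 : ℝ) 1 := right_mem_Icc.mpr zero_le_one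
  have hwε : MemL2 fun s => w s + ε • η s := MemLp.add hw (MemLp.const_smul hη ε)
  have hpos : ∀ s, pos a b (fun s => w s + ε • η s) s = pos a b w s + ε • pos 0 0 η s := by
    intro s
    have h1 := pos_add a (ε • 0) b (ε • 0) hw.integrable (hη.integrable.smul ε) s
    have h2 := pos_smul ε 0 0 η s
    simp only [smul_zero, add_zero] at h1 h2
    rw [← h2]
    exact h1
  have hvel : vel b (fun s => w s + ε • η s) 1 = vel b w 1 := by
    have h1 := vel_add b (ε • 0) hw.integrable (hη.integrable.smul ε) 1
    have h2 := vel_smul ε 0 η 1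
    simp only [smul_zero, add_zero, hv] at h1 h2
    rw [← add_zero (vel b w 1), ← h2]
    exact h1
  have hrefl : ∀ f : ℝ → V, EqOn f f (Icc 0 1) := fun _ _ _ => rfl
  refine ⟨memW22_of_eqOn_pos hwε (hrefl _), fun i => ?_, ?_⟩
  · rw [hpos, hpt, smul_zero, add_zero, ← h (ht i)]
    exact hy.2.1 i
  · have hb := hy.2.2
    have e := velocity_eqOn_vel hw.integrable h
    have e' := velocity_eqOn_vel hwε.integrable (hrefl (pos a b fun s => w s + ε • η s))
    cases bc with
    | natural => trivial
    | hermite v₀ v₁ =>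
      simp only [BoundaryCondition.Holds, e h0, e h1] at hb
      simp only [BoundaryCondition.Holds, e' h0, e' h1, hvel]
      rwa [vel_zero] at hb ⊢
    | periodic =>
      simp only [BoundaryCondition.Holds, e h0, e h1, h h0, h h1] at hb
      simp only [BoundaryCondition.Holds, e' h0, e' h1, hvel, hpos 1, hp, smul_zero, add_zero]
      rwa [vel_zero, pos_zero] at hb ⊢

/-- The acceleration of a spline interpolation has a Hölder continuous representative: its metric
dual is Hölder continuous by `exists_holderHalf_of_weak_bound`, raising the index gives the covariant
acceleration, and subtracting the Christoffel term gives the acceleration. -/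
theorem MetricBounds.exists_holderHalf_acceleration (h : MetricBounds ι g c M) {σ : ℝ} (hσ : 0 ≤ σ)
    {n : ℕ} {t : Fin (n + 1) → ℝ} (ht : ∀ i, t i ∈ Icc (0 : ℝ) 1) {p : Fin (n + 1) → V}
    {bc : BoundaryCondition V} {y : ℝ → V} (hy : IsSplineInterpolation g σ t p bc y) :
    ∃ (a b : V) (w : ℝ → V), HolderHalf w ∧ EqOn y (pos a b w) (Icc 0 1) := by
  classical
  obtain ⟨a, b, w, hw, hrep⟩ := hy.1.1.exists_eqOn_pos
  have hwi := hw.integrable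
  obtain ⟨f, hf2, hf⟩ := h.exists_dual_field (continuous_pos (a := a) (b := b) hwi)
    (h.memL2_cov a b hw)
  obtain ⟨K, hK⟩ := h.exists_weak_bound hσ a b hw
  -- test fields that vanish also at the end point `1` respect every type of boundary condition
  obtain ⟨G, hG, hfG⟩ := exists_holderHalf_of_weak_bound (insert 1 (Finset.univ.image t))
    (by simpa using ht) hf2 (K := K) (by
      intro η hη hv hτ
      simp only [hf]
      refine hK η hη fun ε => ?_
      have hc := hy.1.add_smul ht hw hη hrep hv (hτ 1 (by simp)) (fun i => hτ (t i) (by simp)) ε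
      have hle := hy.2 _ hc
      rwa [regSplineEnergy_eq σ hw hrep, regSplineEnergy_eq σ
        (w := fun s => w s + ε • η s) (MemLp.add hw (MemLp.const_smul hη ε)) fun _ _ => rfl] at hle)
  have hpH := holderHalf_pos a b hwi
  obtain ⟨u, hu, hug⟩ := h.exists_holderHalf_sharp hpH hG
  refine ⟨a, b, fun s => u s - christoffel g (pos a b w s) (vel b w s) (vel b w s),
    hu.sub (h.holderHalf_christoffel hpH (HolderHalf.vel b hw)), ?_⟩
  rwa [← pos_congr (w := w)]
  filter_upwards [hfG] with s hs
  have : cov g a b w s = u s := h.eq_of_forall_apply_eq fun z => by rw [hug, ← hf, hs]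
  rw [← this, cov, add_sub_cancel_right]

/-- A curve with a Hölder continuous acceleration belongs to the Hölder space: the pointwise second
derivative within a subinterval is the given representative of the acceleration. -/
theorem memHolderSpace_of_holderHalf {y : ℝ → V} {a b : V} {w : ℝ → V} (hw : HolderHalf w)
    (h : EqOn y (pos a b w) (Icc 0 1)) {δ : ℝ} (hδ : 0 < δ) (hδ' : δ < 1 / 2) :
    MemHolderSpace 2 (1 / 2) δ (1 - δ) y := by
  have hsub : Icc δ (1 - δ) ⊆ Icc (0 : ℝ) 1 := Icc_subset_Icc hδ.le (by linarith)
  have h0 : (0 : ℝ) ∈ Icc (0 : ℝ) 1 := left_mem_Icc.mpr zero_le_one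
  -- extend the acceleration to a continuous function on the real line
  set w' : ℝ → V := fun t => w (projIcc 0 1 zero_le_one t) with hw'
  have hwc : Continuous w' :=
    (continuousOn_iff_continuous_domRestrict.mp hw.continuousOn).comp continuous_projIcc
  have hww' : EqOn w' w (Icc 0 1) := fun t ht => by
    change w (projIcc 0 1 zero_le_one t : Icc (0 : ℝ) 1) = w t
    rw [projIcc_of_mem zero_le_one ht]
  have hae : w =ᵐ[unitMeasure] w' := by
    filter_upwards [ae_unitMeasure_mem] with t ht using (hww' (Ioo_subset_Icc_self ht)).symm
  set v : ℝ → V := fun t => b + ∫ s in (0 : ℝ)..t, w' s with hv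
  have hvd : ∀ t, HasDerivAt v (w' t) t := fun t =>
    (hwc.integral_hasStrictDerivAt 0 t).hasDerivAt.const_add b
  have hvc : Continuous v := continuous_iff_continuousAt.mpr fun t => (hvd t).continuousAt
  set z : ℝ → V := fun t => a + ∫ s in (0 : ℝ)..t, v s with hz
  have hzd : ∀ t, HasDerivAt z (v t) t := fun t =>
    (hvc.integral_hasStrictDerivAt 0 t).hasDerivAt.const_add a
  have hvel : EqOn v (vel b w) (Icc 0 1) := fun t ht => by
    rw [vel_congr hae, vel, intervalIntegral_unitMeasure _ h0 ht]
  have hyz : EqOn y z (Icc 0 1) := fun t ht => by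
    rw [h ht, pos, hz]
    congr 1
    refine intervalIntegral.integral_congr fun s hs => ?_
    rw [uIcc_of_le ht.1] at hs
    exact (hvel ⟨hs.1, hs.2.trans ht.2⟩).symm
  have hdz : deriv z = v := funext fun t => (hzd t).deriv
  have hdv : deriv v = w' := funext fun t => (hvd t).deriv
  have hv1 : ContDiff ℝ 1 v :=
    contDiff_one_iff_deriv.mpr ⟨fun t => (hvd t).differentiableAt, by rwa [hdv]⟩
  have hz2 : ContDiff ℝ 2 z := by
    rw [show (2 : WithTop ℕ∞) = 1 + 1 from by norm_num, contDiff_succ_iff_deriv]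
    exact ⟨fun t => (hzd t).differentiableAt, by simp, by rwa [hdz]⟩
  have hyz' : EqOn y z (Icc δ (1 - δ)) := hyz.mono hsub
  have hder : EqOn (iteratedDerivWithin 2 y (Icc δ (1 - δ))) w (Icc δ (1 - δ)) := by
    intro t ht
    rw [iteratedDerivWithin_congr hyz' ht, iteratedDerivWithin_eq_iteratedDeriv
      (uniqueDiffOn_Icc (by linarith)) hz2.contDiffAt ht, iteratedDeriv_succ, iteratedDeriv_one,
      hdz, hdv]
    exact hww' (hsub ht)
  obtain ⟨C, hC, hf⟩ := hw
  refine ⟨hz2.contDiffOn.congr hyz', C.toNNReal, fun s hs t ht => ?_⟩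
  rw [hder hs, hder ht, edist_comm, edist_dist, edist_comm s t, edist_dist t s,
    ENNReal.ofReal_rpow_of_nonneg dist_nonneg (by norm_num)]
  change _ ≤ ENNReal.ofReal C * _
  rw [← ENNReal.ofReal_mul hC]
  refine ENNReal.ofReal_le_ofReal ?_
  rw [dist_eq_norm, Real.dist_eq]
  refine (hf s (hsub hs) t (hsub ht)).trans_eq ?_
  rw [Real.sqrt_eq_rpow]
  norm_num

end Regularity

end RiemannianSpline

end

theorem theorem2p4 {V Y : Type*}
    [NormedAddCommGroup V] [InnerProductSpace ℝ V] [CompleteSpace V]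
    [TopologicalSpace.SeparableSpace V]
    [NormedAddCommGroup Y] [NormedSpace ℝ Y] [CompleteSpace Y]
    (ι : V →L[ℝ] Y) (hι_inj : Function.Injective ι) (hι_compact : IsCompactOperator ι)
    (g : V → V →L[ℝ] V →L[ℝ] ℝ) (hg : RiemannianSpline.IsAdmissibleMetric ι g)
    (σ : ℝ) (hσ : 0 < σ)
    {n : ℕ} (t : Fin (n + 1) → ℝ) (ht : ∀ i, t i ∈ Set.Icc (0 : ℝ) 1) (ht_mono : StrictMono t)
    (p : Fin (n + 1) → V)
    (bc : RiemannianSpline.BoundaryCondition V) (hbc : bc.Compatible t) :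
    (∃ y : ℝ → V, RiemannianSpline.IsSplineInterpolation g σ t p bc y) ∧
    ∀ y : ℝ → V, RiemannianSpline.IsSplineInterpolation g σ t p bc y →
      ∀ δ : ℝ, 0 < δ → δ < 1 / 2 →
        RiemannianSpline.MemHolderSpace 2 (1 / 2) δ (1 - δ) y := by
  obtain ⟨c, M, h⟩ := hg.exists_metricBounds
  refine ⟨h.exists_isSplineInterpolation hι_compact hσ ht
    (RiemannianSpline.exists_isCompetitor t ht ht_mono p bc hbc), fun y hy δ hδ hδ' => ?_⟩
  obtain ⟨a, b, w, hw, he⟩ := h.exists_holderHalf_acceleration hσ.le ht hy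
  exact RiemannianSpline.memHolderSpace_of_holderHalf hw he hδ hδ'
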